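/- Let $X_1,X_2,\dots$ be i.i.d. non-negative random variables with distribution function $F$. Assume that $F$ is continuous and that $F$ has first and second derivatives $f$ and $f'$ on $[0,\infty)$ (one-sided at $0$) which are continuous and bounded on $[0,\infty)$. Let $F_n(x)=\frac1n\sum_{i=1}^n \mathbb I(X_i\le x)$ be the empirical distribution function and, for real $m>0$, let $$\hat F_{m,n}(x)=\sum_{k=0}^\infty F_n\!\left(\tfrac km\right)e^{-mx}\frac{(mx)^k}{k!},\qquad x\ge 0,$$ be the Szasz estimator of $F$. Fix $a>0$ and put $$\mathrm{MISE}[\hat F_{m,n}]=\mathbb E\left[\int_0^\infty\big(\hat F_{m,n}(x)-F(x)\big)^2e^{-ax}f(x)\,dx\right],$$ $$C_1=\int_0^\infty F(x)(1-F(x))e^{-ax}f(x)\,dx,\quad C_2=\int_0^\infty f(x)\Big(\frac x\pi\Big)^{1/2}e^{-ax}f(x)\,dx,\quad C_3=\int_0^\infty\Big(\frac{xf'(x)}2\Big)^2e^{-ax}f(x)\,dx .$$ Then $C_2>0$ and $C_3>0$, and the asymptotically optimal choice of $m$ with respect to MISE is $$m_{opt}(n)=n^{2/3}\left[\frac{4C_3}{C_2}\right]^{2/3}.$$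 That is, call a real sequence $m(n)\to\infty$ asymptotically MISE-optimal if for every real sequence $m'(n)\to\infty$ and every $\varepsilon>0$ one has $\mathrm{MISE}[\hat F_{m(n),n}]\le \mathrm{MISE}[\hat F_{m'(n),n}]+\varepsilon n^{-4/3}$ for all sufficiently large $n$. Then $m_{opt}$ is asymptotically MISE-optimal, and a sequence $m(n)$ is asymptotically MISE-optimal if and only if $m(n)/m_{opt}(n)\to1$. Moreover, as $n\to\infty$, $$\mathrm{MISE}[\hat F_{m_{opt}(n),n}]=n^{-1}C_1-\frac34 n^{-4/3}\left[\frac{C_2^4}{4C_3}\right]^{1/3}+o(n^{-4/3}),$$ and the same expansion holds with $m_{opt}$ replaced by any sequence $m(n)$ with $m(n)/m_{opt}(n)\to1$ (for instance $m_{opt}$ rounded to an integer). -/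

import Mathlib

open MeasureTheory ProbabilityTheory Filter Topology Asymptotics Set

noncomputable section

/-- The empirical distribution function `F_n(x) = n⁻¹ ∑_{i < n} 1{X_i ≤ x}` of the first `n`
observations, at the outcome `ω`. -/
def empiricalCDF {Ω : Type*} (X : ℕ → Ω → ℝ) (n : ℕ) (ω : Ω) (x : ℝ) : ℝ :=
  (1 / (n : ℝ)) * ∑ i ∈ Finset.range n, (Set.Iic x).indicator (fun _ => (1 : ℝ)) (X i ω)

/-- The Poisson weight `V_{k,m}(x) = e^{-mx} (mx)^k / k!`. The smoothing parameter `m` is a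
positive real number; the natural numbers are a special case. -/
def szaszWeight (k : ℕ) (m x : ℝ) : ℝ :=
  Real.exp (-(m * x)) * (m * x) ^ k / (Nat.factorial k : ℝ)

/-- The Szasz-Mirakyan operator `S_m(u; x) = ∑_{k ≥ 0} u(k/m) V_{k,m}(x)`. -/
def szaszOperator (m : ℝ) (u : ℝ → ℝ) (x : ℝ) : ℝ :=
  ∑' k : ℕ, u ((k : ℝ) / m) * szaszWeight k m x

/-- The Szasz estimator: the Szasz-Mirakyan operator applied to the empirical distribution
function. -/
def szaszEstimator {Ω : Type*} (X : ℕ → Ω → ℝ) (m : ℝ) (n : ℕ) (ω : Ω) (x : ℝ) : ℝ :=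
  szaszOperator m (empiricalCDF X n ω) x

/-- The mean integrated squared error of the Szasz estimator of `F`, with weight function
`e^{-ax} f(x)` on the half line. -/
def szaszMISE {Ω : Type*} [MeasurableSpace Ω] (P : Measure Ω) (X : ℕ → Ω → ℝ)
    (F f : ℝ → ℝ) (a : ℝ) (m : ℝ) (n : ℕ) : ℝ :=
  ∫ ω, (∫ x in Set.Ioi (0 : ℝ),
    (szaszEstimator X m n ω x - F x) ^ 2 * (Real.exp (-(a * x)) * f x)) ∂P

/-- `C₁ = ∫₀^∞ σ²(x) e^{-ax} f(x) dx` with `σ²(x) = F(x) (1 - F(x))`. -/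
def szaszC1 (F f : ℝ → ℝ) (a : ℝ) : ℝ :=
  ∫ x in Set.Ioi (0 : ℝ), (F x * (1 - F x)) * (Real.exp (-(a * x)) * f x)

/-- `C₂ = ∫₀^∞ V(x) e^{-ax} f(x) dx` with `V(x) = f(x) (x/π)^{1/2}`. -/
def szaszC2 (f : ℝ → ℝ) (a : ℝ) : ℝ :=
  ∫ x in Set.Ioi (0 : ℝ), (f x * Real.sqrt (x / Real.pi)) * (Real.exp (-(a * x)) * f x)

/-- `C₃ = ∫₀^∞ b(x)² e^{-ax} f(x) dx` with `b(x) = x f'(x) / 2`. -/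
def szaszC3 (f f' : ℝ → ℝ) (a : ℝ) : ℝ :=
  ∫ x in Set.Ioi (0 : ℝ), (x * f' x / 2) ^ 2 * (Real.exp (-(a * x)) * f x)

/-- `m_opt(n) = n^{2/3} [4 C₃ / C₂]^{2/3}`. -/
def szaszMOpt (f f' : ℝ → ℝ) (a : ℝ) (n : ℕ) : ℝ :=
  (n : ℝ) ^ ((2 : ℝ) / 3) * (4 * szaszC3 f f' a / szaszC2 f a) ^ ((2 : ℝ) / 3)

/-- A choice `n ↦ m n` of the smoothing parameter, tending to infinity, is asymptotically optimal
for the error criterion `M`, to the order `r`, if no other choice that tends to infinity has an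
error that is smaller by more than `o(r n)`. -/
def IsAsymptoticallyOptimal (M : ℝ → ℕ → ℝ) (r : ℕ → ℝ) (m : ℕ → ℝ) : Prop :=
  Tendsto m atTop atTop ∧
    ∀ m' : ℕ → ℝ, Tendsto m' atTop atTop →
      ∀ ε : ℝ, 0 < ε → ∀ᶠ n in atTop, M (m n) n ≤ M (m' n) n + ε * r n

/-- The choice `n ↦ m n` of the smoothing parameter leads to
`MISE = n⁻¹ C₁ - (3/4) n^{-4/3} [C₂⁴ / (4 C₃)]^{1/3} + o(n^{-4/3})`. -/
def HasOptimalMISEExpansion {Ω : Type*} [MeasurableSpace Ω] (P : Measure Ω) (X : ℕ → Ω → ℝ)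
    (F f f' : ℝ → ℝ) (a : ℝ) (m : ℕ → ℝ) : Prop :=
  (fun n : ℕ => szaszMISE P X F f a (m n) n -
      ((n : ℝ)⁻¹ * szaszC1 F f a -
        (3 / 4) * (n : ℝ) ^ (-(4 : ℝ) / 3) *
          ((szaszC2 f a) ^ 4 / (4 * szaszC3 f f' a)) ^ ((1 : ℝ) / 3)))
    =o[atTop] (fun n : ℕ => (n : ℝ) ^ (-(4 : ℝ) / 3))

end

/-! The estimator at `x` is an average of i.i.d. kernels `szaszKernel m (X i) x`, so its mean
squared error is (variance of one kernel)/n plus squared bias. If `N`, `N'` are independent Poisson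
variables of parameter `m x`, the kernel has mean E F(N/m) and second moment E F(min(N, N')/m).

Taylor expansion and the Poisson moments give the bias x f'(x)/(2m) + o(1/m)
(`tendsto_mul_szaszOperator_sub`). Since min(N, N') = (N + N')/2 - |N - N'|/2, the second moment is
F(x) - f(x) E|N - N'|/(2m) + O(1/m). The asymptotics E|N - N'| ~ 2 √(m x/π)
(`tendsto_integral_abs_sub_poissonMeasure_prod`) then produce the gain f(x) √(x/π) m^{-1/2} in the
variance. Dominated convergence against (1 + x)² e^{-ax} integrates both expansions, so MISE is C₁/n
- C₂ n⁻¹ m^{-1/2} + C₃ m⁻², with errors o(n⁻¹ m^{-1/2}) and o(m⁻²) as m → ∞.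

Put s = √(m_opt/m). The excess over the claimed optimum, times n^{4/3}, is a positive constant times
C₃ (s⁴ - 4s + 3) + o(1) s + o(1) s⁴. The gap s⁴ - 4s + 3 is at least 3 (s - 1)², and s + s⁴ is at
most twice the gap plus 10. The errors are therefore absorbed for every sequence m → ∞, even if s is
unbounded, and near-optimality is the same as s → 1. Positivity of C₂ and C₃ holds because a bounded
distribution function cannot be affine with positive slope on the half line
(`exists_deriv_mul_ne_zero`). -/

/-! ### Moments of the Poisson distribution -/

section Poisson

open scoped NNReal

/-- The index shift n · rⁿ/n! = r · rⁿ⁻¹/(n-1)!. Iterating it yields all factorial moments. -/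
lemma hasSum_poisson_natCast_mul {r S : ℝ} {g : ℕ → ℝ}
    (h : HasSum (fun n : ℕ => (Real.exp (-r) * r ^ n / (Nat.factorial n : ℝ)) * g (n + 1)) S) :
    HasSum (fun n : ℕ => (Real.exp (-r) * r ^ n / (Nat.factorial n : ℝ)) * ((n : ℝ) * g n))
      (r * S) := by
  rw [← hasSum_nat_add_iff' 1]
  simp only [Finset.sum_range_one, Nat.cast_zero, zero_mul, mul_zero, sub_zero]
  convert! h.mul_left r using 2 with n
  rw [Nat.factorial_succ]
  have : ((n : ℝ) + 1) ≠ 0 := by positivity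
  have h2 : (Nat.factorial n : ℝ) ≠ 0 := by positivity
  push_cast
  field_simp
  ring_nf

lemma hasSum_poisson_one (r : ℝ) :
    HasSum (fun n : ℕ => (Real.exp (-r) * r ^ n / (Nat.factorial n : ℝ)) * 1) 1 := by
  have := (NormedSpace.expSeries_div_hasSum_exp r).mul_left (Real.exp (-r))
  rw [← Real.exp_eq_exp_ℝ, ← Real.exp_add, neg_add_cancel, Real.exp_zero] at this
  simpa only [mul_one, mul_div_assoc] using this

lemma hasSum_poisson_id (r : ℝ) :
    HasSum (fun n : ℕ => (Real.exp (-r) * r ^ n / (Nat.factorial n : ℝ)) * (n : ℝ)) r := by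
  simpa using hasSum_poisson_natCast_mul (g := fun _ => 1) (hasSum_poisson_one r)

lemma hasSum_poisson_factorial_two (r : ℝ) :
    HasSum (fun n : ℕ => (Real.exp (-r) * r ^ n / (Nat.factorial n : ℝ)) *
      ((n : ℝ) * ((n : ℝ) - 1))) (r * r) :=
  hasSum_poisson_natCast_mul (g := fun n => (n : ℝ) - 1) (by simpa using hasSum_poisson_id r)

lemma hasSum_poisson_factorial_three (r : ℝ) :
    HasSum (fun n : ℕ => (Real.exp (-r) * r ^ n / (Nat.factorial n : ℝ)) *
      ((n : ℝ) * (((n : ℝ) - 1) * ((n : ℝ) - 2)))) (r * (r * r)) :=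
  hasSum_poisson_natCast_mul (g := fun n => ((n : ℝ) - 1) * ((n : ℝ) - 2)) (by
    convert hasSum_poisson_factorial_two r using 3
    push_cast; ring)

lemma hasSum_poisson_factorial_four (r : ℝ) :
    HasSum (fun n : ℕ => (Real.exp (-r) * r ^ n / (Nat.factorial n : ℝ)) *
      ((n : ℝ) * (((n : ℝ) - 1) * (((n : ℝ) - 2) * ((n : ℝ) - 3))))) (r * (r * (r * r))) :=
  hasSum_poisson_natCast_mul (g := fun n => ((n : ℝ) - 1) * (((n : ℝ) - 2) * ((n : ℝ) - 3))) (by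
    convert hasSum_poisson_factorial_three r using 3
    push_cast; ring)

lemma hasSum_poisson_central_two (r : ℝ) :
    HasSum (fun n : ℕ => (Real.exp (-r) * r ^ n / (Nat.factorial n : ℝ)) * ((n : ℝ) - r) ^ 2)
      r := by
  convert! ((hasSum_poisson_factorial_two r).add
    ((hasSum_poisson_id r).mul_left (1 - 2 * r))).add
    ((hasSum_poisson_one r).mul_left (r ^ 2)) using 1
  · ext n; ring
  · ring

lemma hasSum_poisson_central_four (r : ℝ) :
    HasSum (fun n : ℕ => (Real.exp (-r) * r ^ n / (Nat.factorial n : ℝ)) * ((n : ℝ) - r) ^ 4)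
      (3 * r ^ 2 + r) := by
  -- The coefficients expand (n - r)⁴ in falling factorials, using n⁴ = n₍₄₎ + 6 n₍₃₎ + 7 n₍₂₎ +
  -- n₍₁₎ and n³ = n₍₃₎ + 3 n₍₂₎ + n₍₁₎.
  convert! ((((hasSum_poisson_factorial_four r).add
    ((hasSum_poisson_factorial_three r).mul_left (6 - 4 * r))).add
    ((hasSum_poisson_factorial_two r).mul_left (7 - 12 * r + 6 * r ^ 2))).add
    ((hasSum_poisson_id r).mul_left (1 - 4 * r + 6 * r ^ 2 - 4 * r ^ 3))).add
    ((hasSum_poisson_one r).mul_left (r ^ 4)) using 1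
  · ext n; ring
  · ring

lemma integrable_poissonMeasure_of_hasSum {r : ℝ≥0} {g : ℕ → ℝ} {S : ℝ} (hg : ∀ n, 0 ≤ g n)
    (h : HasSum (fun n : ℕ => (Real.exp (-r) * r ^ n / (Nat.factorial n : ℝ)) * g n) S) :
    Integrable g (poissonMeasure r) := by
  rw [integrable_poissonMeasure_iff]
  simpa only [Real.norm_of_nonneg (hg _)] using h.summable

lemma integral_poissonMeasure_of_hasSum {r : ℝ≥0} {g : ℕ → ℝ} {S : ℝ}
    (h : HasSum (fun n : ℕ => (Real.exp (-r) * r ^ n / (Nat.factorial n : ℝ)) * g n) S) :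
    ∫ n, g n ∂(poissonMeasure r) = S := by
  rw [integral_poissonMeasure]
  simpa only [smul_eq_mul] using h.tsum_eq

lemma integrable_natCast_poissonMeasure (r : ℝ≥0) :
    Integrable (fun n : ℕ => (n : ℝ)) (poissonMeasure r) :=
  integrable_poissonMeasure_of_hasSum (fun n => n.cast_nonneg) (hasSum_poisson_id r)

lemma integral_natCast_poissonMeasure (r : ℝ≥0) :
    ∫ n : ℕ, (n : ℝ) ∂(poissonMeasure r) = r :=
  integral_poissonMeasure_of_hasSum (hasSum_poisson_id r)

lemma integrable_sub_sq_poissonMeasure (r : ℝ≥0) :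
    Integrable (fun n : ℕ => ((n : ℝ) - r) ^ 2) (poissonMeasure r) :=
  integrable_poissonMeasure_of_hasSum (fun _ => sq_nonneg _) (hasSum_poisson_central_two r)

lemma integral_sub_sq_poissonMeasure (r : ℝ≥0) :
    ∫ n : ℕ, ((n : ℝ) - r) ^ 2 ∂(poissonMeasure r) = r :=
  integral_poissonMeasure_of_hasSum (hasSum_poisson_central_two r)

lemma integrable_sub_pow_four_poissonMeasure (r : ℝ≥0) :
    Integrable (fun n : ℕ => ((n : ℝ) - r) ^ 4) (poissonMeasure r) :=
  integrable_poissonMeasure_of_hasSum (fun _ => by positivity) (hasSum_poisson_central_four r)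

lemma integral_sub_pow_four_poissonMeasure (r : ℝ≥0) :
    ∫ n : ℕ, ((n : ℝ) - r) ^ 4 ∂(poissonMeasure r) = 3 * (r : ℝ) ^ 2 + r :=
  integral_poissonMeasure_of_hasSum (hasSum_poisson_central_four r)

/-! ### The mean absolute difference of two independent Poisson variables -/

/-- 1 - cos u is at most u²/2 and at most 2; together these give the majorant (2 + d²)/(1 + t²). -/
lemma integrableOn_one_sub_cos_div_sq (d : ℝ) :
    IntegrableOn (fun t : ℝ => (1 - Real.cos (t * d)) / t ^ 2) (Ioi 0) := by
  refine Integrable.mono' ((integrable_inv_one_add_sq.const_mul (2 + d ^ 2)).integrableOn)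
    (Measurable.aestronglyMeasurable (by fun_prop)) ((ae_restrict_iff' measurableSet_Ioi).2 (ae_of_all _ fun t ht => ?_))
  have ht : 0 < t := ht
  have h1 := Real.one_sub_sq_div_two_le_cos (x := t * d)
  have h2 := Real.neg_one_le_cos (t * d)
  have h3 := Real.cos_le_one (t * d)
  rw [Real.norm_of_nonneg (by apply div_nonneg <;> nlinarith [sq_nonneg t]), ← div_eq_mul_inv,
    div_le_div_iff₀ (by positivity) (by positivity)]
  nlinarith [mul_nonneg (sq_nonneg t) (by linarith : 0 ≤ 1 + Real.cos (t * d)),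
    mul_nonneg (sq_nonneg t) (sq_nonneg d)]

lemma integral_one_sub_cos_div_sq (d : ℝ) :
    ∫ t in Ioi (0 : ℝ), (1 - Real.cos (t * d)) / t ^ 2 =
      |d| * ∫ t in Ioi (0 : ℝ), (1 - Real.cos t) / t ^ 2 := by
  rcases eq_or_ne d 0 with rfl | hd
  · simp
  have h := integral_comp_mul_left_Ioi (fun t : ℝ => (1 - Real.cos t) / t ^ 2) 0 (abs_pos.2 hd)
  rw [mul_zero, smul_eq_mul] at h
  have h0 : |d| ≠ 0 := abs_ne_zero.2 hd
  rw [eq_comm, inv_mul_eq_iff_eq_mul₀ h0] at h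
  rw [h, ← mul_assoc, ← integral_const_mul]
  refine setIntegral_congr_fun measurableSet_Ioi fun t ht => ?_
  have ht : t ≠ 0 := ne_of_gt ht
  have : Real.cos (|d| * t) = Real.cos (t * d) := by
    rw [← Real.cos_abs (t * d), ← Real.cos_abs (|d| * t), abs_mul, abs_mul, abs_abs, mul_comm]
  simp only [this]
  field_simp

/-- The value of this constant is never needed: it cancels between the Poisson and the Gaussian
case, which only requires it to be nonzero. -/
lemma integral_one_sub_cos_div_sq_pos :
    0 < ∫ t in Ioi (0 : ℝ), (1 - Real.cos t) / t ^ 2 := by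
  have hint : IntegrableOn (fun t : ℝ => (1 - Real.cos t) / t ^ 2) (Ioi 0) := by
    simpa using integrableOn_one_sub_cos_div_sq 1
  have hnn : ∀ t : ℝ, 0 ≤ (1 - Real.cos t) / t ^ 2 := fun t =>
    div_nonneg (sub_nonneg.2 (Real.cos_le_one t)) (sq_nonneg t)
  rw [setIntegral_pos_iff_support_of_nonneg_ae (ae_of_all _ hnn) hint]
  refine lt_of_lt_of_le ?_ (measure_mono (s := Ioo (0 : ℝ) 1) fun t ht => ⟨?_, ht.1⟩)
  · simp
  · have h1 : Real.cos t < 1 := by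
      rw [← Real.cos_zero]
      exact Real.cos_lt_cos_of_nonneg_of_le_pi le_rfl
        (by linarith [ht.2, Real.pi_gt_three]) ht.1
    have := ht.1
    exact (div_pos (sub_pos.2 h1) (by positivity)).ne'

/-- Fubini applied to the cosine representation of |d|. It reduces the limit of a first absolute
moment to convergence of characteristic functions. -/
lemma integral_abs_mul_eq_integral_one_sub_cos {Ω : Type*} [MeasurableSpace Ω] (Q : Measure Ω)
    [IsProbabilityMeasure Q] {D : Ω → ℝ} (hD : Measurable D) (hint : Integrable D Q) :
    (∫ ω, |D ω| ∂Q) * ∫ t in Ioi (0 : ℝ), (1 - Real.cos t) / t ^ 2 =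
      ∫ t in Ioi (0 : ℝ), (1 - ∫ ω, Real.cos (t * D ω) ∂Q) / t ^ 2 := by
  have hnn : ∀ t d : ℝ, 0 ≤ (1 - Real.cos (t * d)) / t ^ 2 := fun t d =>
    div_nonneg (sub_nonneg.2 (Real.cos_le_one _)) (sq_nonneg t)
  have hI : Integrable (Function.uncurry fun (ω : Ω) (t : ℝ) =>
      (1 - Real.cos (t * D ω)) / t ^ 2) (Q.prod (volume.restrict (Ioi 0))) := by
    rw [integrable_prod_iff (by
      apply Measurable.aestronglyMeasurable; unfold Function.uncurry; fun_prop)]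
    refine ⟨ae_of_all _ fun ω => integrableOn_one_sub_cos_div_sq (D ω), ?_⟩
    simp only [Function.uncurry, Real.norm_of_nonneg (hnn _ _), integral_one_sub_cos_div_sq]
    exact hint.abs.mul_const _
  rw [← integral_mul_const]
  simp_rw [← integral_one_sub_cos_div_sq]
  rw [integral_integral_swap hI]
  refine integral_congr_ae (ae_of_all _ fun t => ?_)
  have hc : Integrable (fun ω => Real.cos (t * D ω)) Q :=
    Integrable.of_bound (by fun_prop) 1 (ae_of_all _ fun ω => by simpa using Real.abs_cos_le_one _)
  simp only
  rw [integral_div, integral_sub (integrable_const _) hc]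
  simp

/-- Variance 2 is that of (N - N')/√r, whose Gaussian limit supplies the constant 2/√π. -/
lemma integral_cos_gaussianReal_two (t : ℝ) :
    ∫ x, Real.cos (t * x) ∂(gaussianReal 0 2) = Real.exp (-t ^ 2) := by
  have h := charFun_gaussianReal (μ := 0) (v := 2) t
  rw [charFun_apply_real] at h
  have h2 := congrArg Complex.re h
  have hint : Integrable (fun x : ℝ => Complex.exp (t * x * Complex.I)) (gaussianReal 0 2) :=
    Integrable.of_bound (by fun_prop) 1 (ae_of_all _ fun x => by
      rw [← Complex.ofReal_mul, Complex.norm_exp_ofReal_mul_I])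
  rw [← RCLike.re_eq_complex_re, ← integral_re hint, RCLike.re_eq_complex_re] at h2
  convert h2 using 1
  · congr 1; ext x
    rw [← Complex.ofReal_mul, Complex.exp_ofReal_mul_I_re]
  · rw [show ((t : ℂ) * ((0 : ℝ) : ℂ) * Complex.I - ((2 : ℝ≥0) : ℂ) * (t : ℂ) ^ 2 / 2)
      = ((-t ^ 2 : ℝ) : ℂ) by push_cast; ring, ← Complex.ofReal_exp, Complex.ofReal_re]

lemma integral_abs_gaussianReal_two :
    ∫ x, |x| ∂(gaussianReal 0 2) = 2 / Real.sqrt Real.pi := by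
  rw [integral_gaussianReal_eq_integral_smul (by norm_num)]
  have h : ∀ x : ℝ, gaussianPDFReal 0 2 x • |x| =
      (Real.sqrt (2 * Real.pi * 2))⁻¹ * (|x| * Real.exp (-(1 / 4) * |x| ^ 2)) := fun x => by
    simp only [gaussianPDFReal, smul_eq_mul, sq_abs, sub_zero]
    push_cast
    ring_nf
  simp_rw [h]
  rw [integral_const_mul, integral_comp_abs (f := fun x : ℝ => x * Real.exp (-(1 / 4) * x ^ 2))]
  have h2 := integral_rpow_mul_exp_neg_mul_rpow (p := 2) (q := 1) (b := 1 / 4)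
    (by norm_num) (by norm_num) (by norm_num)
  norm_num at h2
  rw [show (∫ x in Ioi (0 : ℝ), x * Real.exp (-(1 / 4) * x ^ 2)) = 2 by simpa using h2, show (2 * Real.pi * 2) = 2 ^ 2 * Real.pi by ring, Real.sqrt_mul (by norm_num),
    Real.sqrt_sq (by norm_num)]
  have : Real.sqrt Real.pi ≠ 0 := (Real.sqrt_pos.2 Real.pi_pos).ne'
  field_simp

/-- By independence the left side is (E cos tN)² + (E sin tN)², the squared modulus of the Poisson
characteristic function. -/
lemma integral_cos_poissonMeasure_prod (r : ℝ≥0) (t : ℝ) :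
    ∫ p : ℕ × ℕ, Real.cos (t * ((p.1 : ℝ) - p.2)) ∂((poissonMeasure r).prod (poissonMeasure r)) =
      Real.exp (-(2 * r * (1 - Real.cos t))) := by
  set μ := poissonMeasure r
  have hexp : ∫ n : ℕ, Complex.exp (t * n * Complex.I) ∂μ =
      Complex.exp (r * (Complex.exp (t * Complex.I) - 1)) := by
    rw [← charFun_map_cast_poissonMeasure, charFun_apply_real,
      integral_map .of_discrete (by fun_prop)]
    simp [μ]
  have hexpint : Integrable (fun n : ℕ => Complex.exp (t * n * Complex.I)) μ :=
    Integrable.of_bound (by fun_prop) 1 (ae_of_all _ fun x => by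
      rw [← Complex.ofReal_natCast, ← Complex.ofReal_mul, Complex.norm_exp_ofReal_mul_I])
  have hre : ∫ n : ℕ, Real.cos (t * n) ∂μ =
      (Complex.exp (r * (Complex.exp (t * Complex.I) - 1))).re := by
    rw [← hexp, ← RCLike.re_eq_complex_re, ← integral_re hexpint]
    congr 1; ext n
    rw [RCLike.re_eq_complex_re, ← Complex.ofReal_natCast, ← Complex.ofReal_mul,
      Complex.exp_ofReal_mul_I_re]
  have him : ∫ n : ℕ, Real.sin (t * n) ∂μ =
      (Complex.exp (r * (Complex.exp (t * Complex.I) - 1))).im := by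
    rw [← hexp, ← RCLike.im_eq_complex_im, ← integral_im hexpint]
    congr 1; ext n
    rw [RCLike.im_eq_complex_im, ← Complex.ofReal_natCast, ← Complex.ofReal_mul,
      Complex.exp_ofReal_mul_I_im]
  have hc : Integrable (fun n : ℕ => Real.cos (t * n)) μ :=
    Integrable.of_bound (by fun_prop) 1 (ae_of_all _ fun ω => by simpa using Real.abs_cos_le_one _)
  have hs : Integrable (fun n : ℕ => Real.sin (t * n)) μ :=
    Integrable.of_bound (by fun_prop) 1 (ae_of_all _ fun ω => by simpa using Real.abs_sin_le_one _)
  simp_rw [mul_sub t, Real.cos_sub]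
  rw [integral_add (hc.mul_prod hc) (hs.mul_prod hs),
    integral_prod_mul (fun n : ℕ => Real.cos (t * n)) (fun n : ℕ => Real.cos (t * n)),
    integral_prod_mul (fun n : ℕ => Real.sin (t * n)) (fun n : ℕ => Real.sin (t * n)), hre, him,
    ← Complex.normSq_apply, Complex.normSq_eq_norm_sq, Complex.norm_exp, ← Real.exp_nat_mul]
  congr 1
  simp only [Complex.mul_re, Complex.sub_re, Complex.one_re, Complex.sub_im, Complex.one_im,
    Complex.exp_ofReal_mul_I_re]
  simp
  ring

lemma integrable_sub_poissonMeasure_prod (r : ℝ≥0) :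
    Integrable (fun p : ℕ × ℕ => (p.1 : ℝ) - p.2)
      ((poissonMeasure r).prod (poissonMeasure r)) :=
  ((integrable_natCast_poissonMeasure r).comp_fst _).sub
    ((integrable_natCast_poissonMeasure r).comp_snd _)

lemma integral_abs_sub_poissonMeasure_prod_mul (r : ℝ≥0) (hr : 0 < r) :
    ((∫ p : ℕ × ℕ, |(p.1 : ℝ) - p.2| ∂((poissonMeasure r).prod (poissonMeasure r))) /
        Real.sqrt r) * ∫ t in Ioi (0 : ℝ), (1 - Real.cos t) / t ^ 2 =
      ∫ t in Ioi (0 : ℝ), (1 - Real.exp (-(2 * r * (1 - Real.cos (t / Real.sqrt r))))) / t ^ 2 := by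
  have hs : 0 < Real.sqrt r := Real.sqrt_pos.2 hr
  rw [div_mul_eq_mul_div, integral_abs_mul_eq_integral_one_sub_cos _ (by fun_prop)
    (integrable_sub_poissonMeasure_prod r)]
  simp_rw [integral_cos_poissonMeasure_prod]
  have h := integral_comp_mul_left_Ioi
    (fun t : ℝ => (1 - Real.exp (-(2 * r * (1 - Real.cos t)))) / t ^ 2) 0 (inv_pos.2 hs)
  rw [mul_zero, inv_inv, smul_eq_mul] at h
  rw [div_eq_iff hs.ne', eq_comm, mul_comm, ← mul_right_inj' hs.ne', ← h, ← integral_const_mul,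
    ← integral_const_mul]
  refine setIntegral_congr_fun measurableSet_Ioi fun t ht => ?_
  have ht : t ≠ 0 := ne_of_gt ht
  simp only [inv_mul_eq_div]
  field_simp

lemma tendsto_two_mul_one_sub_cos_div_sqrt (t : ℝ) :
    Tendsto (fun r : ℝ => 2 * r * (1 - Real.cos (t / Real.sqrt r))) atTop (𝓝 (t ^ 2)) := by
  rw [tendsto_iff_norm_sub_tendsto_zero]
  have h0 : Tendsto (fun r : ℝ => t ^ 4 / r) atTop (𝓝 0) :=
    tendsto_const_nhds.div_atTop tendsto_id
  refine squeeze_zero' (Eventually.of_forall fun r => norm_nonneg _) ?_ h0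
  filter_upwards [eventually_ge_atTop (max 1 (t ^ 2))] with r hr
  have hr1 : 1 ≤ r := (le_max_left _ _).trans hr
  have hr2 : t ^ 2 ≤ r := (le_max_right _ _).trans hr
  have hs : 0 < Real.sqrt r := Real.sqrt_pos.2 (by linarith)
  have hsq : (t / Real.sqrt r) ^ 2 = t ^ 2 / r := by
    rw [div_pow, Real.sq_sqrt (by linarith)]
  have hu : |t / Real.sqrt r| ≤ 1 := by
    rw [← sq_le_one_iff_abs_le_one, hsq]
    exact (div_le_one (by linarith)).2 hr2
  have hb := Real.cos_bound hu
  have h4 : |t / Real.sqrt r| ^ 4 = t ^ 4 / r ^ 2 := by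
    rw [show 4 = 2 * 2 from rfl, pow_mul, sq_abs, hsq, div_pow, ← pow_mul]
  rw [h4, hsq] at hb
  have hrr : r ≠ 0 := by positivity
  have : 2 * r * (1 - Real.cos (t / Real.sqrt r)) - t ^ 2 =
      -(2 * r) * (Real.cos (t / Real.sqrt r) - (1 - t ^ 2 / r / 2)) := by
    field_simp; ring
  rw [this, norm_mul, norm_neg, Real.norm_of_nonneg (by positivity), Real.norm_eq_abs]
  calc 2 * r * |Real.cos (t / Real.sqrt r) - (1 - t ^ 2 / r / 2)|
      ≤ 2 * r * (t ^ 4 / r ^ 2 * (5 / 96)) := by gcongr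
    _ = t ^ 4 / r * (10 / 96) := by field_simp; ring
    _ ≤ t ^ 4 / r := mul_le_of_le_one_right (by positivity) (by norm_num)

/-- The exponent y satisfies 0 ≤ y ≤ t², so 1 - e^{-y} is at most both 1 and t²; this gives a
majorant independent of r. -/
lemma tendsto_integral_one_sub_exp_cos :
    Tendsto (fun r : ℝ => ∫ t in Ioi (0 : ℝ),
        (1 - Real.exp (-(2 * r * (1 - Real.cos (t / Real.sqrt r))))) / t ^ 2) atTop
      (𝓝 (∫ t in Ioi (0 : ℝ), (1 - Real.exp (-t ^ 2)) / t ^ 2)) := by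
  refine tendsto_integral_filter_of_dominated_convergence (fun t : ℝ => 2 * (1 + t ^ 2)⁻¹)
    (Eventually.of_forall fun r => Measurable.aestronglyMeasurable (by fun_prop)) ?_
    (integrable_inv_one_add_sq.const_mul 2).integrableOn ?_
  · filter_upwards [eventually_gt_atTop 0] with r hr
    refine (ae_restrict_iff' measurableSet_Ioi).2 (ae_of_all _ fun t ht => ?_)
    have ht : 0 < t := ht
    have hs : 0 < Real.sqrt r := Real.sqrt_pos.2 hr
    set y := 2 * r * (1 - Real.cos (t / Real.sqrt r)) with hy
    have hy0 : 0 ≤ y := mul_nonneg (by positivity) (sub_nonneg.2 (Real.cos_le_one _))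
    have hyt : y ≤ t ^ 2 := by
      have h1 := Real.one_sub_sq_div_two_le_cos (x := t / Real.sqrt r)
      rw [div_pow, Real.sq_sqrt hr.le] at h1
      calc y ≤ 2 * r * (t ^ 2 / r / 2) := by rw [hy]; gcongr; linarith
        _ = t ^ 2 := by field_simp
    have he1 : Real.exp (-y) ≤ 1 := Real.exp_le_one_iff.2 (by linarith)
    have he2 : 1 - y ≤ Real.exp (-y) := by linarith [Real.add_one_le_exp (-y)]
    have he3 := Real.exp_pos (-y)
    rw [Real.norm_of_nonneg (div_nonneg (by linarith) (by positivity)), ← div_eq_mul_inv,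
      div_le_div_iff₀ (by positivity) (by positivity)]
    nlinarith [sq_nonneg t]
  · exact ae_of_all _ fun t => ((tendsto_const_nhds.sub
      ((tendsto_two_mul_one_sub_cos_div_sqrt t).neg.rexp)).div_const _)

/-- The mean absolute difference of two independent Poisson variables of rate `r` is asymptotic
to `2 √(r / π)`. -/
lemma tendsto_integral_abs_sub_poissonMeasure_prod :
    Tendsto (fun r : ℝ => (∫ p : ℕ × ℕ, |(p.1 : ℝ) - p.2|
        ∂((poissonMeasure r.toNNReal).prod (poissonMeasure r.toNNReal))) / Real.sqrt r) atTop
      (𝓝 (2 / Real.sqrt Real.pi)) := by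
  have hc := integral_one_sub_cos_div_sq_pos
  -- The same identity for the Gaussian limit evaluates the limiting integral up to the unknown
  -- constant, which then cancels.
  have hG := integral_abs_mul_eq_integral_one_sub_cos (gaussianReal 0 2) (D := id)
    measurable_id ((memLp_id_gaussianReal 1).integrable (by norm_num))
  simp only [id, integral_cos_gaussianReal_two, integral_abs_gaussianReal_two] at hG
  have h := tendsto_integral_one_sub_exp_cos.div_const
    (∫ t in Ioi (0 : ℝ), (1 - Real.cos t) / t ^ 2)
  rw [← hG, mul_div_cancel_right₀ _ hc.ne'] at h
  refine h.congr' ?_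
  filter_upwards [eventually_gt_atTop 0] with r hr
  have := integral_abs_sub_poissonMeasure_prod_mul r.toNNReal (Real.toNNReal_pos.2 hr)
  rw [Real.coe_toNNReal r hr.le] at this
  rw [← this, mul_div_cancel_right₀ _ hc.ne']

/-- A non-asymptotic bound, needed for domination in `x`. It follows from |d| ≤ (d²/√r + √r)/2 at d
= N - r and d = N' - r, together with Var N = r. -/
lemma integral_abs_sub_poissonMeasure_prod_le {r : ℝ≥0} (hr : 0 < r) :
    ∫ p : ℕ × ℕ, |(p.1 : ℝ) - p.2| ∂((poissonMeasure r).prod (poissonMeasure r)) ≤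
      2 * Real.sqrt r := by
  have hs : 0 < Real.sqrt r := Real.sqrt_pos.2 hr
  set μ := poissonMeasure r
  have h1 : ∀ d : ℝ, |d| ≤ (d ^ 2 / Real.sqrt r + Real.sqrt r) / 2 := fun d => by
    have := sq_nonneg (|d| - Real.sqrt r)
    rw [le_div_iff₀ (by norm_num), ← sq_abs d, div_add' _ _ _ hs.ne', le_div_iff₀ hs]
    nlinarith
  have hi : Integrable (fun k : ℕ => (((k : ℝ) - r) ^ 2 / Real.sqrt r + Real.sqrt r) / 2) μ :=
    (((integrable_sub_sq_poissonMeasure r).div_const (Real.sqrt r)).add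
    (integrable_const (Real.sqrt r))).div_const 2
  have hint : ∫ k : ℕ, (((k : ℝ) - r) ^ 2 / Real.sqrt r + Real.sqrt r) / 2 ∂μ = Real.sqrt r := by
    rw [integral_div, integral_add ((integrable_sub_sq_poissonMeasure r).div_const _)
      (integrable_const _), integral_div, integral_sub_sq_poissonMeasure]
    simp
  calc ∫ p : ℕ × ℕ, |(p.1 : ℝ) - p.2| ∂(μ.prod μ)
      ≤ ∫ p : ℕ × ℕ, ((((p.1 : ℝ) - r) ^ 2 / Real.sqrt r + Real.sqrt r) / 2 +
          (((p.2 : ℝ) - r) ^ 2 / Real.sqrt r + Real.sqrt r) / 2) ∂(μ.prod μ) := by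
        refine integral_mono (integrable_sub_poissonMeasure_prod r).abs
          ((hi.comp_fst μ).add (hi.comp_snd μ)) fun p => ?_
        calc |(p.1 : ℝ) - p.2| ≤ |(p.1 : ℝ) - r| + |(p.2 : ℝ) - r| := by
              rw [abs_sub_comm (p.2 : ℝ)]; exact abs_sub_le _ _ _
          _ ≤ _ := add_le_add (h1 _) (h1 _)
    _ = 2 * Real.sqrt r := by
        rw [integral_add (hi.comp_fst μ) (hi.comp_snd μ),
          integral_fun_fst (f := fun k : ℕ => (((k : ℝ) - r) ^ 2 / Real.sqrt r + Real.sqrt r) / 2),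
          integral_fun_snd (f := fun k : ℕ => (((k : ℝ) - r) ^ 2 / Real.sqrt r + Real.sqrt r) / 2),
          hint]
        simp; ring

end Poisson

/-! ### Taylor estimates on the half line -/

section Taylor

variable {F f f' : ℝ → ℝ}

/-- The mean value inequality on the segment from `x` to `y`, applied to the Taylor remainder. The
choice c = 0 gives a first order estimate; c = f'(x) on a small ball gives the second order one. -/
lemma abs_taylor_two_sub_le {x c K : ℝ} {s : Set ℝ} (hs : Convex ℝ s) (hs0 : s ⊆ Ici 0)
    (hx : x ∈ s)
    (hf : ∀ x ∈ Ici (0 : ℝ), HasDerivWithinAt F (f x) (Ici 0) x)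
    (hK : ∀ y ∈ s, |f y - f x - c * (y - x)| ≤ K * |y - x|) :
    ∀ y ∈ s, |F y - F x - f x * (y - x) - c / 2 * (y - x) ^ 2| ≤ K * (y - x) ^ 2 := by
  intro y hy
  have hxy : uIcc x y ⊆ s := by
    rw [← segment_eq_uIcc]; exact hs.segment_subset hx hy
  have hderiv : ∀ z ∈ uIcc x y, HasDerivWithinAt
      (fun z => F z - F x - f x * (z - x) - c / 2 * (z - x) ^ 2)
      (f z - f x - c * (z - x)) (uIcc x y) z := by
    intro z hz
    have h1 := (hf z (hs0 (hxy hz))).mono (hxy.trans hs0)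
    have h2 : HasDerivWithinAt (fun z => z - x) 1 (uIcc x y) z :=
      (hasDerivWithinAt_id z _).sub_const x
    convert! ((h1.sub_const (F x)).sub (h2.const_mul (f x))).sub
      ((h2.pow 2).const_mul (c / 2)) using 1
    norm_num; ring
  have hbound : ∀ z ∈ uIcc x y, ‖f z - f x - c * (z - x)‖ ≤ K * |y - x| := by
    intro z hz
    have h0 : |z - x| ≤ |y - x| := by
      exact abs_sub_left_of_mem_uIcc hz
    rcases eq_or_ne y x with rfl | hne
    · have : z = y := by simpa using hz
      subst this; simp
    · have hK0 : 0 ≤ K := by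
        have := (abs_nonneg _).trans (hK y hy)
        exact nonneg_of_mul_nonneg_left this (abs_pos.2 (sub_ne_zero.2 hne))
      exact (hK z (hxy hz)).trans (by gcongr)
  have := (convex_uIcc x y).norm_image_sub_le_of_norm_hasDerivWithin_le hderiv hbound
    left_mem_uIcc right_mem_uIcc
  simp only [sub_self, mul_zero, ne_eq, OfNat.ofNat_ne_zero, not_false_eq_true, zero_pow,
    sub_zero, Real.norm_eq_abs] at this
  rwa [mul_assoc, ← sq, sq_abs] at this

lemma abs_taylor_one_sub_le {B : ℝ}
    (hf : ∀ x ∈ Ici (0 : ℝ), HasDerivWithinAt F (f x) (Ici 0) x)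
    (hf' : ∀ x ∈ Ici (0 : ℝ), HasDerivWithinAt f (f' x) (Ici 0) x)
    (hB : ∀ x ∈ Ici (0 : ℝ), |f' x| ≤ B) {x y : ℝ} (hx : 0 ≤ x) (hy : 0 ≤ y) :
    |F y - F x - f x * (y - x)| ≤ B * (y - x) ^ 2 := by
  have := abs_taylor_two_sub_le (c := 0) (K := B) (convex_Ici 0) le_rfl hx hf (fun z hz => by
    simpa using (convex_Ici (0 : ℝ)).norm_image_sub_le_of_norm_hasDerivWithin_le hf' hB
      hx hz) y hy
  simpa using this

lemma exists_abs_taylor_two_sub_le {x ε : ℝ} (hx : 0 ≤ x) (hε : 0 < ε)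
    (hf : ∀ x ∈ Ici (0 : ℝ), HasDerivWithinAt F (f x) (Ici 0) x)
    (hf' : ∀ x ∈ Ici (0 : ℝ), HasDerivWithinAt f (f' x) (Ici 0) x) :
    ∃ δ > 0, ∀ y, 0 ≤ y → |y - x| < δ →
      |F y - F x - f x * (y - x) - f' x / 2 * (y - x) ^ 2| ≤ ε * (y - x) ^ 2 := by
  have h := (hasDerivWithinAt_iff_isLittleO.1 (hf' x hx)).def hε
  obtain ⟨δ, hδ, h⟩ := Metric.mem_nhdsWithin_iff.1 h
  refine ⟨δ, hδ, fun y hy hyx => ?_⟩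
  refine abs_taylor_two_sub_le (s := Metric.ball x δ ∩ Ici 0)
    ((convex_ball x δ).inter (convex_Ici 0)) inter_subset_right
    ⟨Metric.mem_ball_self hδ, hx⟩ hf (fun z hz => ?_) y ⟨by simpa [Real.dist_eq] using hyx, hy⟩
  have := h hz
  simpa [mul_comm] using this

/-- A second order Taylor estimate that holds on the whole half line, with a quartic remainder. -/
lemma exists_abs_taylor_two_sub_le_add {x ε B : ℝ} (hx : 0 ≤ x) (hε : 0 < ε)
    (hf : ∀ x ∈ Ici (0 : ℝ), HasDerivWithinAt F (f x) (Ici 0) x)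
    (hf' : ∀ x ∈ Ici (0 : ℝ), HasDerivWithinAt f (f' x) (Ici 0) x)
    (hB : ∀ x ∈ Ici (0 : ℝ), |f' x| ≤ B) :
    ∃ C, ∀ y, 0 ≤ y →
      |F y - F x - f x * (y - x) - f' x / 2 * (y - x) ^ 2| ≤
        ε * (y - x) ^ 2 + C * (y - x) ^ 4 := by
  obtain ⟨δ, hδ, h⟩ := exists_abs_taylor_two_sub_le hx hε hf hf'
  have hB0 : 0 ≤ B := (abs_nonneg _).trans (hB x hx)
  -- Outside the δ-ball both the first order remainder and the quadratic term are at most B (y -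
  -- x)², and (y - x)² ≤ (y - x)⁴/δ². A quartic term is affordable because the fourth central moment
  -- of N/m is O(m⁻²).
  refine ⟨2 * B / δ ^ 2, fun y hy => ?_⟩
  rcases lt_or_ge |y - x| δ with hd | hd
  · have : 0 ≤ 2 * B / δ ^ 2 * (y - x) ^ 4 := by positivity
    linarith [h y hy hd]
  · have h1 := abs_taylor_one_sub_le hf hf' hB hx hy
    have h2 : |f' x / 2 * (y - x) ^ 2| ≤ B * (y - x) ^ 2 := by
      rw [abs_mul, abs_of_nonneg (sq_nonneg (y - x)), abs_div, abs_two]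
      have := hB x hx
      gcongr
      linarith [abs_nonneg (f' x)]
    have h3 : δ ^ 2 ≤ (y - x) ^ 2 := by rw [← sq_abs (y - x)]; gcongr
    have h4 : 2 * B * (y - x) ^ 2 ≤ 2 * B / δ ^ 2 * (y - x) ^ 4 := by
      rw [div_mul_eq_mul_div, le_div_iff₀ (by positivity)]
      calc 2 * B * (y - x) ^ 2 * δ ^ 2 ≤ 2 * B * (y - x) ^ 2 * (y - x) ^ 2 := by gcongr
        _ = _ := by ring
    have h5 : 0 ≤ ε * (y - x) ^ 2 := by positivity
    calc _ ≤ |F y - F x - f x * (y - x)| + |f' x / 2 * (y - x) ^ 2| := abs_sub _ _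
      _ ≤ _ := by linarith

end Taylor

/-! ### Szasz operators and the Poisson distribution -/

section Szasz

/-- The law of a Poisson variable with parameter `m x`: the measure on `ℕ` behind the
Szasz-Mirakyan operator. -/
noncomputable def szaszMeasure (m x : ℝ) : Measure ℕ := poissonMeasure (m * x).toNNReal

instance (m x : ℝ) : IsProbabilityMeasure (szaszMeasure m x) := by
  unfold szaszMeasure; infer_instance

variable {m x : ℝ}

lemma szaszOperator_eq_integral (hm : 0 ≤ m) (hx : 0 ≤ x) (u : ℝ → ℝ) :
    szaszOperator m u x = ∫ k : ℕ, u (k / m) ∂(szaszMeasure m x) := by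
  rw [szaszMeasure, integral_poissonMeasure, szaszOperator]
  simp only [szaszWeight, Real.coe_toNNReal _ (mul_nonneg hm hx), smul_eq_mul, mul_comm (u _)]

lemma natCast_div_sub_eq (hm : 0 < m) (hx : 0 ≤ x) (k : ℕ) :
    (k : ℝ) / m - x = ((k : ℝ) - (m * x).toNNReal) / m := by
  rw [Real.coe_toNNReal _ (mul_nonneg hm.le hx)]
  field_simp

lemma integrable_sub_szaszMeasure (hm : 0 < m) (hx : 0 ≤ x) :
    Integrable (fun k : ℕ => (k : ℝ) / m - x) (szaszMeasure m x) := by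
  simp only [natCast_div_sub_eq hm hx]
  exact ((integrable_natCast_poissonMeasure _).sub (integrable_const _)).div_const _

lemma integral_sub_szaszMeasure (hm : 0 < m) (hx : 0 ≤ x) :
    ∫ k : ℕ, ((k : ℝ) / m - x) ∂(szaszMeasure m x) = 0 := by
  simp only [natCast_div_sub_eq hm hx]
  rw [szaszMeasure, integral_div, integral_sub (integrable_natCast_poissonMeasure _)
    (integrable_const _), integral_natCast_poissonMeasure]
  simp

lemma integrable_sub_sq_szaszMeasure (hm : 0 < m) (hx : 0 ≤ x) :
    Integrable (fun k : ℕ => ((k : ℝ) / m - x) ^ 2) (szaszMeasure m x) := by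
  simp only [natCast_div_sub_eq hm hx, div_pow]
  exact (integrable_sub_sq_poissonMeasure _).div_const _

lemma integral_sub_sq_szaszMeasure (hm : 0 < m) (hx : 0 ≤ x) :
    ∫ k : ℕ, ((k : ℝ) / m - x) ^ 2 ∂(szaszMeasure m x) = x / m := by
  simp only [natCast_div_sub_eq hm hx, div_pow]
  rw [szaszMeasure, integral_div, integral_sub_sq_poissonMeasure,
    Real.coe_toNNReal _ (mul_nonneg hm.le hx)]
  field_simp

lemma integrable_sub_pow_four_szaszMeasure (hm : 0 < m) (hx : 0 ≤ x) :
    Integrable (fun k : ℕ => ((k : ℝ) / m - x) ^ 4) (szaszMeasure m x) := by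
  simp only [natCast_div_sub_eq hm hx, div_pow]
  exact (integrable_sub_pow_four_poissonMeasure _).div_const _

lemma integral_sub_pow_four_szaszMeasure (hm : 0 < m) (hx : 0 ≤ x) :
    ∫ k : ℕ, ((k : ℝ) / m - x) ^ 4 ∂(szaszMeasure m x) = 3 * x ^ 2 / m ^ 2 + x / m ^ 3 := by
  simp only [natCast_div_sub_eq hm hx, div_pow]
  rw [szaszMeasure, integral_div, integral_sub_pow_four_poissonMeasure,
    Real.coe_toNNReal _ (mul_nonneg hm.le hx)]
  field_simp

lemma integrable_abs_sub_szaszMeasure_prod :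
    Integrable (fun p : ℕ × ℕ => |(p.1 : ℝ) - p.2|)
      ((szaszMeasure m x).prod (szaszMeasure m x)) :=
  (integrable_sub_poissonMeasure_prod _).abs

lemma integral_abs_sub_szaszMeasure_prod_le (hm : 0 < m) (hx : 0 < x) :
    ∫ p : ℕ × ℕ, |(p.1 : ℝ) - p.2| ∂((szaszMeasure m x).prod (szaszMeasure m x)) ≤
      2 * Real.sqrt (m * x) := by
  have hmx : 0 < m * x := mul_pos hm hx
  have := integral_abs_sub_poissonMeasure_prod_le (Real.toNNReal_pos.2 hmx)
  rwa [Real.coe_toNNReal _ hmx.le] at this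

lemma tendsto_integral_abs_sub_szaszMeasure_prod (hx : 0 < x) :
    Tendsto (fun m : ℝ => Real.sqrt m * ((∫ p : ℕ × ℕ, |(p.1 : ℝ) - p.2|
        ∂((szaszMeasure m x).prod (szaszMeasure m x))) / (2 * m))) atTop
      (𝓝 (Real.sqrt (x / Real.pi))) := by
  have h := (tendsto_integral_abs_sub_poissonMeasure_prod.comp
    (tendsto_id.atTop_mul_const hx)).mul_const (Real.sqrt x / 2)
  have e : 2 / Real.sqrt Real.pi * (Real.sqrt x / 2) = Real.sqrt (x / Real.pi) := by
    rw [Real.sqrt_div hx.le]; ring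
  rw [e] at h
  refine h.congr' ?_
  filter_upwards [eventually_gt_atTop 0] with m hm
  have hs : Real.sqrt m ≠ 0 := (Real.sqrt_pos.2 hm).ne'
  have hsx : Real.sqrt x ≠ 0 := (Real.sqrt_pos.2 hx).ne'
  simp only [Function.comp, id, szaszMeasure]
  rw [Real.sqrt_mul hm.le]
  field_simp
  rw [Real.sq_sqrt hm.le, mul_comm]

end Szasz

/-! ### Pointwise expansions of the bias and the variance -/

section SzaszPointwise

variable {F f f' : ℝ → ℝ} {B m x : ℝ}

/-- The second moment of the smoothed indicator: `E F(min(N, N') / m)` for independent Poisson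
variables `N`, `N'` of parameter `m x`. -/
noncomputable def szaszSecondMoment (F : ℝ → ℝ) (m x : ℝ) : ℝ :=
  ∫ p : ℕ × ℕ, F (min ((p.1 : ℝ) / m) ((p.2 : ℝ) / m))
    ∂((szaszMeasure m x).prod (szaszMeasure m x))

lemma integrable_comp_div_szaszMeasure (hF1 : ∀ y, |F y| ≤ 1) :
    Integrable (fun k : ℕ => F (k / m)) (szaszMeasure m x) :=
  Integrable.of_bound (Measurable.of_discrete).aestronglyMeasurable 1 (ae_of_all _ fun _ => hF1 _)

/-- The linear term integrates to zero because N/m has mean x, and the quadratic one gives the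
variance x/m. -/
lemma abs_szaszOperator_sub_le (hm : 0 < m) (hx : 0 ≤ x) (hF1 : ∀ y, |F y| ≤ 1)
    (hT : ∀ y, 0 ≤ y → |F y - F x - f x * (y - x)| ≤ B * (y - x) ^ 2) :
    |szaszOperator m F x - F x| ≤ B * (x / m) := by
  have hF := integrable_comp_div_szaszMeasure (m := m) (x := x) hF1
  have hFc : Integrable (fun k : ℕ => F (k / m) - F x) (szaszMeasure m x) :=
    hF.sub (integrable_const _)
  have h1 := (integrable_sub_szaszMeasure hm hx).const_mul (f x)
  have e : szaszOperator m F x - F x =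
      ∫ k : ℕ, (F (k / m) - F x - f x * (k / m - x)) ∂(szaszMeasure m x) := by
    rw [integral_sub hFc h1, integral_sub hF (integrable_const _),
      integral_const_mul, integral_sub_szaszMeasure hm hx, szaszOperator_eq_integral hm.le hx]
    simp
  rw [e, ← Real.norm_eq_abs, ← integral_sub_sq_szaszMeasure hm hx, ← integral_const_mul]
  refine norm_integral_le_of_norm_le ((integrable_sub_sq_szaszMeasure hm hx).const_mul B)
    (ae_of_all _ fun k => hT (k / m) (by positivity))

lemma abs_szaszOperator_sub_sub_le {c C ε : ℝ} (hm : 0 < m) (hx : 0 ≤ x)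
    (hF1 : ∀ y, |F y| ≤ 1)
    (hT : ∀ y, 0 ≤ y → |F y - F x - f x * (y - x) - c / 2 * (y - x) ^ 2| ≤
      ε * (y - x) ^ 2 + C * (y - x) ^ 4) :
    |szaszOperator m F x - F x - c / 2 * (x / m)| ≤
      ε * (x / m) + C * (3 * x ^ 2 / m ^ 2 + x / m ^ 3) := by
  have hF := integrable_comp_div_szaszMeasure (m := m) (x := x) hF1
  have hFc : Integrable (fun k : ℕ => F (k / m) - F x) (szaszMeasure m x) :=
    hF.sub (integrable_const _)
  have h1 := (integrable_sub_szaszMeasure hm hx).const_mul (f x)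
  have hFl : Integrable (fun k : ℕ => F (k / m) - F x - f x * (k / m - x)) (szaszMeasure m x) :=
    hFc.sub h1
  have h2 := integrable_sub_sq_szaszMeasure hm hx
  have h4 := integrable_sub_pow_four_szaszMeasure hm hx
  have e : szaszOperator m F x - F x - c / 2 * (x / m) =
      ∫ k : ℕ, (F (k / m) - F x - f x * (k / m - x) - c / 2 * (k / m - x) ^ 2)
        ∂(szaszMeasure m x) := by
    rw [integral_sub hFl (h2.const_mul _), integral_sub hFc h1, integral_sub hF (integrable_const _),
      integral_const_mul, integral_const_mul, integral_sub_szaszMeasure hm hx,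
      integral_sub_sq_szaszMeasure hm hx, szaszOperator_eq_integral hm.le hx]
    simp
  rw [e, ← Real.norm_eq_abs, ← integral_sub_sq_szaszMeasure hm hx, ← integral_sub_pow_four_szaszMeasure hm hx,
    ← integral_const_mul, ← integral_const_mul, ← integral_add (h2.const_mul _) (h4.const_mul _)]
  refine norm_integral_le_of_norm_le ((h2.const_mul _).add (h4.const_mul _))
    (ae_of_all _ fun k => hT (k / m) (by positivity))

/-- Voronovskaya's theorem for the Szasz-Mirakyan operator. -/
lemma tendsto_mul_szaszOperator_sub {c : ℝ} (hx : 0 ≤ x) (hF1 : ∀ y, |F y| ≤ 1)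
    (hT : ∀ ε > 0, ∃ C, ∀ y, 0 ≤ y → |F y - F x - f x * (y - x) - c / 2 * (y - x) ^ 2| ≤
      ε * (y - x) ^ 2 + C * (y - x) ^ 4) :
    Tendsto (fun m : ℝ => m * (szaszOperator m F x - F x)) atTop (𝓝 (x * c / 2)) := by
  rw [Metric.tendsto_atTop']
  intro η hη
  -- The denominator x + 1 makes the ε-term at most η/2 after multiplication by m, and is safe at x
  -- = 0.
  obtain ⟨C, hC⟩ := hT (η / (2 * (x + 1))) (by positivity)
  have hlim : Tendsto (fun m : ℝ => C * (3 * x ^ 2 / m + x / m ^ 2)) atTop (𝓝 0) := by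
    simpa using ((tendsto_const_nhds.div_atTop tendsto_id).add
      (tendsto_const_nhds.div_atTop (tendsto_pow_atTop (two_ne_zero)))).const_mul C
  obtain ⟨N, hN⟩ := eventually_atTop.1 (hlim.eventually (gt_mem_nhds (half_pos hη)))
  refine ⟨max N 0, fun m hm => ?_⟩
  have hm0 : 0 < m := (le_max_right _ _).trans_lt hm
  have h1 := hN m ((le_max_left _ _).trans hm.le)
  have h2 := abs_szaszOperator_sub_sub_le hm0 hx hF1 hC
  have e : m * (szaszOperator m F x - F x) - x * c / 2 =
      m * (szaszOperator m F x - F x - c / 2 * (x / m)) := by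
    field_simp
  have e2 : m * (η / (2 * (x + 1)) * (x / m) + C * (3 * x ^ 2 / m ^ 2 + x / m ^ 3)) =
      η / 2 * (x / (x + 1)) + C * (3 * x ^ 2 / m + x / m ^ 2) := by
    field_simp
  rw [Real.dist_eq, e, abs_mul, abs_of_pos hm0]
  have h3 := mul_le_mul_of_nonneg_left h2 hm0.le
  rw [e2] at h3
  have h5 : x / (x + 1) ≤ 1 := (div_le_one (by positivity)).2 (by linarith)
  nlinarith

/-- In min(u, v) = (u + v)/2 - |u - v|/2 the mean part is centred at x, so only the absolute
difference survives at first order. -/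
lemma abs_szaszSecondMoment_sub_le (hm : 0 < m) (hx : 0 ≤ x) (hF1 : ∀ y, |F y| ≤ 1)
    (hT : ∀ y, 0 ≤ y → |F y - F x - f x * (y - x)| ≤ B * (y - x) ^ 2) (hB : 0 ≤ B) :
    |szaszSecondMoment F m x - F x + f x * ((∫ p : ℕ × ℕ, |(p.1 : ℝ) - p.2|
        ∂((szaszMeasure m x).prod (szaszMeasure m x))) / (2 * m))| ≤ 2 * B * (x / m) := by
  set μ := szaszMeasure m x with hμ
  have hF : Integrable (fun p : ℕ × ℕ => F (min ((p.1 : ℝ) / m) ((p.2 : ℝ) / m))) (μ.prod μ) :=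
    Integrable.of_bound (Measurable.of_discrete).aestronglyMeasurable 1
      (ae_of_all _ fun _ => hF1 _)
  have h1 := integrable_sub_szaszMeasure hm hx
  have h2 := integrable_sub_sq_szaszMeasure hm hx
  have hmin : ∀ p : ℕ × ℕ, min ((p.1 : ℝ) / m) ((p.2 : ℝ) / m) - x =
      (((p.1 : ℝ) / m - x) + ((p.2 : ℝ) / m - x)) / 2 - |(p.1 : ℝ) - p.2| / (2 * m) := fun p => by
    have h := inf_eq_half_smul_add_sub_abs_sub' ℝ (p.1 : ℝ) p.2
    rw [smul_eq_mul, abs_sub_comm] at h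
    rw [min_div_div_right hm.le, h]
    field_simp
    ring
  have hi : Integrable (fun p : ℕ × ℕ => (((p.1 : ℝ) / m - x) + ((p.2 : ℝ) / m - x)) / 2)
      (μ.prod μ) := ((h1.comp_fst μ).add (h1.comp_snd μ)).div_const 2
  have hi0 : ∫ p : ℕ × ℕ, (((p.1 : ℝ) / m - x) + ((p.2 : ℝ) / m - x)) / 2 ∂(μ.prod μ) = 0 := by
    rw [integral_div, integral_add (h1.comp_fst μ) (h1.comp_snd μ),
      integral_fun_fst (f := fun k : ℕ => (k : ℝ) / m - x),
      integral_fun_snd (f := fun k : ℕ => (k : ℝ) / m - x), integral_sub_szaszMeasure hm hx]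
    simp
  have ha : Integrable (fun p : ℕ × ℕ => |(p.1 : ℝ) - p.2| / (2 * m)) (μ.prod μ) :=
    integrable_abs_sub_szaszMeasure_prod.div_const _
  have hlin : Integrable (fun p : ℕ × ℕ => f x * ((((p.1 : ℝ) / m - x) + ((p.2 : ℝ) / m - x)) / 2 -
      |(p.1 : ℝ) - p.2| / (2 * m))) (μ.prod μ) := (hi.sub ha).const_mul (f x)
  have hFc : Integrable (fun p : ℕ × ℕ => F (min ((p.1 : ℝ) / m) ((p.2 : ℝ) / m)) - F x)
      (μ.prod μ) := hF.sub (integrable_const _)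
  have hsq : Integrable (fun p : ℕ × ℕ => B * (((p.1 : ℝ) / m - x) ^ 2 + ((p.2 : ℝ) / m - x) ^ 2))
      (μ.prod μ) := ((h2.comp_fst μ).add (h2.comp_snd μ)).const_mul B
  have e : szaszSecondMoment F m x - F x + f x * ((∫ p : ℕ × ℕ, |(p.1 : ℝ) - p.2|
        ∂(μ.prod μ)) / (2 * m)) =
      ∫ p : ℕ × ℕ, (F (min ((p.1 : ℝ) / m) ((p.2 : ℝ) / m)) - F x -
        f x * ((((p.1 : ℝ) / m - x) + ((p.2 : ℝ) / m - x)) / 2 - |(p.1 : ℝ) - p.2| / (2 * m)))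
        ∂(μ.prod μ) := by
    rw [integral_sub hFc hlin, integral_sub hF (integrable_const _),
      integral_const_mul, integral_sub hi ha, hi0, integral_div, szaszSecondMoment,
      ← hμ]
    simp
  have e2 : 2 * B * (x / m) =
      ∫ p : ℕ × ℕ, B * (((p.1 : ℝ) / m - x) ^ 2 + ((p.2 : ℝ) / m - x) ^ 2) ∂(μ.prod μ) := by
    rw [integral_const_mul, integral_add (h2.comp_fst μ) (h2.comp_snd μ),
      integral_fun_fst (f := fun k : ℕ => ((k : ℝ) / m - x) ^ 2),
      integral_fun_snd (f := fun k : ℕ => ((k : ℝ) / m - x) ^ 2),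
      integral_sub_sq_szaszMeasure hm hx]
    simp; ring
  rw [e, e2, ← Real.norm_eq_abs]
  refine norm_integral_le_of_norm_le hsq (ae_of_all _ fun p => ?_)
  rw [← hmin]
  refine (hT _ (by positivity)).trans (mul_le_mul_of_nonneg_left ?_ hB)
  -- The minimum is one of its two arguments, so its squared deviation is at most the sum of both.
  rcases min_choice ((p.1 : ℝ) / m) ((p.2 : ℝ) / m) with h | h <;> rw [h]
  · exact le_add_of_nonneg_right (sq_nonneg _)
  · exact le_add_of_nonneg_left (sq_nonneg _)

lemma abs_szaszOperator_le (hm : 0 ≤ m) (hx : 0 ≤ x) (hF1 : ∀ y, |F y| ≤ 1) :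
    |szaszOperator m F x| ≤ 1 := by
  rw [szaszOperator_eq_integral hm hx, ← Real.norm_eq_abs]
  simpa using norm_integral_le_of_norm_le_const (μ := szaszMeasure m x)
    (f := fun k : ℕ => F (k / m)) (ae_of_all _ fun k : ℕ => hF1 (k / m))

/-- The variance of the smoothed indicator, compared with `F (1 - F)` and the first order
correction. -/
lemma abs_szaszVariance_sub_le (hm : 0 < m) (hx : 0 ≤ x) (hF1 : ∀ y, |F y| ≤ 1)
    (hT : ∀ y, 0 ≤ y → |F y - F x - f x * (y - x)| ≤ B * (y - x) ^ 2) (hB : 0 ≤ B) :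
    |szaszSecondMoment F m x - szaszOperator m F x ^ 2 - F x * (1 - F x) +
      f x * ((∫ p : ℕ × ℕ, |(p.1 : ℝ) - p.2|
        ∂((szaszMeasure m x).prod (szaszMeasure m x))) / (2 * m))| ≤ 4 * B * (x / m) := by
  have h1 := abs_szaszSecondMoment_sub_le hm hx hF1 hT hB
  have h2 := abs_szaszOperator_sub_le hm hx hF1 hT
  set E := f x * ((∫ p : ℕ × ℕ, |(p.1 : ℝ) - p.2|
        ∂((szaszMeasure m x).prod (szaszMeasure m x))) / (2 * m))
  have h3 : |szaszOperator m F x ^ 2 - F x ^ 2| ≤ 2 * B * (x / m) := by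
    have h4 : |szaszOperator m F x + F x| ≤ 2 := (abs_add_le _ _).trans
      (by linarith [abs_szaszOperator_le hm.le hx hF1, hF1 x])
    rw [sq_sub_sq, abs_mul]
    calc _ ≤ 2 * (B * (x / m)) := by gcongr
      _ = _ := by ring
  have e : szaszSecondMoment F m x - szaszOperator m F x ^ 2 - F x * (1 - F x) + E =
      (szaszSecondMoment F m x - F x + E) - (szaszOperator m F x ^ 2 - F x ^ 2) := by ring
  rw [e]
  refine (abs_sub _ _).trans ?_
  linarith

lemma tendsto_sqrt_mul_szaszVariance_sub (hx : 0 < x) (hF1 : ∀ y, |F y| ≤ 1)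
    (hT : ∀ y, 0 ≤ y → |F y - F x - f x * (y - x)| ≤ B * (y - x) ^ 2) (hB : 0 ≤ B) :
    Tendsto (fun m : ℝ => Real.sqrt m * (szaszSecondMoment F m x - szaszOperator m F x ^ 2 -
      F x * (1 - F x))) atTop (𝓝 (-(f x * Real.sqrt (x / Real.pi)))) := by
  have h1 := (tendsto_integral_abs_sub_szaszMeasure_prod hx).const_mul (f x)
  have h2 : Tendsto (fun m : ℝ => Real.sqrt m * (szaszSecondMoment F m x -
      szaszOperator m F x ^ 2 - F x * (1 - F x) + f x * ((∫ p : ℕ × ℕ, |(p.1 : ℝ) - p.2|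
        ∂((szaszMeasure m x).prod (szaszMeasure m x))) / (2 * m)))) atTop (𝓝 0) := by
    have h0 : Tendsto (fun m : ℝ => 4 * B * x / Real.sqrt m) atTop (𝓝 0) :=
      tendsto_const_nhds.div_atTop Real.tendsto_sqrt_atTop
    refine squeeze_zero_norm' ?_ h0
    filter_upwards [eventually_gt_atTop 0] with m hm
    have hs : 0 < Real.sqrt m := Real.sqrt_pos.2 hm
    rw [norm_mul, Real.norm_of_nonneg hs.le, Real.norm_eq_abs]
    calc _ ≤ Real.sqrt m * (4 * B * (x / m)) := by
          gcongr; exact abs_szaszVariance_sub_le hm hx.le hF1 hT hB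
      _ = 4 * B * x / Real.sqrt m := by
          rw [eq_div_iff hs.ne']
          field_simp
          rw [Real.sq_sqrt hm.le, mul_comm]
  convert! h2.sub h1 using 1
  · ext m; ring
  · simp

/-- The majorant for the integrated variance: uniform in m ≥ 1 (where √m ≤ m) and of linear growth
in x. -/
lemma abs_sqrt_mul_szaszVariance_sub_le {B₀ : ℝ} (hm : 1 ≤ m) (hx : 0 < x)
    (hF1 : ∀ y, |F y| ≤ 1) (hfB : |f x| ≤ B₀)
    (hT : ∀ y, 0 ≤ y → |F y - F x - f x * (y - x)| ≤ B * (y - x) ^ 2) (hB : 0 ≤ B) :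
    |Real.sqrt m * (szaszSecondMoment F m x - szaszOperator m F x ^ 2 - F x * (1 - F x))| ≤
      B₀ * (1 + x) + 4 * B * x := by
  have hm0 : 0 < m := by linarith
  have hs : 0 < Real.sqrt m := Real.sqrt_pos.2 hm0
  have h1 := abs_szaszVariance_sub_le hm0 hx.le hF1 hT hB
  have h2 := integral_abs_sub_szaszMeasure_prod_le hm0 hx
  have h2' : 0 ≤ ∫ p : ℕ × ℕ, |(p.1 : ℝ) - p.2|
        ∂((szaszMeasure m x).prod (szaszMeasure m x)) := integral_nonneg fun _ => abs_nonneg _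
  set J := ∫ p : ℕ × ℕ, |(p.1 : ℝ) - p.2| ∂((szaszMeasure m x).prod (szaszMeasure m x))
  set W := szaszSecondMoment F m x - szaszOperator m F x ^ 2 - F x * (1 - F x)
  have h3 : Real.sqrt m * (J / (2 * m)) ≤ 1 + x := by
    have hxs : Real.sqrt x ≤ 1 + x := by
      rw [Real.sqrt_le_left (by linarith)]; nlinarith
    calc Real.sqrt m * (J / (2 * m)) ≤ Real.sqrt m * (2 * Real.sqrt (m * x) / (2 * m)) := by gcongr
      _ = Real.sqrt x := by
        rw [Real.sqrt_mul hm0.le]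
        field_simp
        rw [Real.sq_sqrt hm0.le]
      _ ≤ 1 + x := hxs
  have h4 : Real.sqrt m * (4 * B * (x / m)) ≤ 4 * B * x := by
    have : Real.sqrt m ≤ m := by
      rw [Real.sqrt_le_left hm0.le]; nlinarith
    calc _ ≤ m * (4 * B * (x / m)) := by gcongr
      _ = _ := by field_simp
  have e : Real.sqrt m * W = Real.sqrt m * (W + f x * (J / (2 * m))) -
      f x * (Real.sqrt m * (J / (2 * m))) := by ring
  have hB₀ : 0 ≤ B₀ := (abs_nonneg _).trans hfB
  rw [e]
  refine (abs_sub _ _).trans ?_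
  rw [abs_mul, abs_mul, abs_of_pos hs, abs_of_nonneg (a := Real.sqrt m * (J / (2 * m)))
    (by positivity)]
  have h5 : Real.sqrt m * |W + f x * (J / (2 * m))| ≤ Real.sqrt m * (4 * B * (x / m)) := by gcongr
  have h6 : |f x| * (Real.sqrt m * (J / (2 * m))) ≤ B₀ * (1 + x) := by gcongr
  linarith

end SzaszPointwise

/-! ### Integration against the weight by dominated convergence -/

section Weight

variable {F f f' : ℝ → ℝ} {B B₀ C a m : ℝ}

lemma integrableOn_one_add_sq_mul_exp (ha : 0 < a) :
    IntegrableOn (fun x : ℝ => (1 + x) ^ 2 * Real.exp (-(a * x))) (Ioi 0) := by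
  have h0 := integrableOn_rpow_mul_exp_neg_mul_rpow (s := 0) (p := 1) (by norm_num) one_pos ha
  have h1 := integrableOn_rpow_mul_exp_neg_mul_rpow (s := 1) (p := 1) (by norm_num) one_pos ha
  have h2 := integrableOn_rpow_mul_exp_neg_mul_rpow (s := 2) (p := 1) (by norm_num) one_pos ha
  refine ((h0.add (h1.const_mul 2)).add h2).congr (ae_of_all _ fun x => ?_)
  simp only [Real.rpow_zero, Real.rpow_one, Real.rpow_two, Pi.add_apply]
  ring_nf

lemma abs_mul_weight_le {c x : ℝ} (hfB : ∀ x ∈ Ici (0 : ℝ), |f x| ≤ B₀) (hx : 0 ≤ x)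
    (hc : |c| ≤ C * (1 + x) ^ 2) :
    ‖c * (Real.exp (-(a * x)) * f x)‖ ≤
      C * B₀ * ((1 + x) ^ 2 * Real.exp (-(a * x))) := by
  rw [norm_mul, norm_mul, Real.norm_of_nonneg (Real.exp_pos _).le, Real.norm_eq_abs,
    Real.norm_eq_abs]
  calc _ ≤ (C * (1 + x) ^ 2) * (Real.exp (-(a * x)) * B₀) := by
        have := (abs_nonneg _).trans hc
        gcongr
        exact hfB x hx
    _ = _ := by ring

lemma aestronglyMeasurable_weight (hfcont : ContinuousOn f (Ici 0)) :
    AEStronglyMeasurable (fun x => Real.exp (-(a * x)) * f x) (volume.restrict (Ioi 0)) :=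
  (Continuous.aestronglyMeasurable (by fun_prop)).mul
    ((hfcont.mono Ioi_subset_Ici_self).aestronglyMeasurable measurableSet_Ioi)

lemma integrableOn_mul_weight (ha : 0 < a) (hfcont : ContinuousOn f (Ici 0))
    (hfB : ∀ x ∈ Ici (0 : ℝ), |f x| ≤ B₀) {g : ℝ → ℝ}
    (hg : AEStronglyMeasurable g (volume.restrict (Ioi 0)))
    (hgC : ∀ x, 0 < x → |g x| ≤ C * (1 + x) ^ 2) :
    IntegrableOn (fun x => g x * (Real.exp (-(a * x)) * f x)) (Ioi 0) :=
  Integrable.mono' ((integrableOn_one_add_sq_mul_exp ha).const_mul (C * B₀))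
    (hg.mul (aestronglyMeasurable_weight hfcont))
    ((ae_restrict_iff' measurableSet_Ioi).2 (ae_of_all _ fun x hx =>
      abs_mul_weight_le hfB (le_of_lt hx) (hgC x hx)))

lemma tendsto_setIntegral_mul_weight (ha : 0 < a) (hfcont : ContinuousOn f (Ici 0))
    (hfB : ∀ x ∈ Ici (0 : ℝ), |f x| ≤ B₀) {g : ℝ → ℝ → ℝ} {h : ℝ → ℝ}
    (hg : ∀ᶠ m in atTop, AEStronglyMeasurable (g m) (volume.restrict (Ioi 0)))
    (hgC : ∀ᶠ m in atTop, ∀ x, 0 < x → |g m x| ≤ C * (1 + x) ^ 2)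
    (hlim : ∀ x, 0 < x → Tendsto (fun m => g m x) atTop (𝓝 (h x))) :
    Tendsto (fun m => ∫ x in Ioi (0 : ℝ), g m x * (Real.exp (-(a * x)) * f x)) atTop
      (𝓝 (∫ x in Ioi (0 : ℝ), h x * (Real.exp (-(a * x)) * f x))) := by
  refine tendsto_integral_filter_of_dominated_convergence
    (fun x => C * B₀ * ((1 + x) ^ 2 * Real.exp (-(a * x)))) ?_ ?_
    ((integrableOn_one_add_sq_mul_exp ha).const_mul _) ?_
  · filter_upwards [hg] with m hm using hm.mul (aestronglyMeasurable_weight hfcont)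
  · filter_upwards [hgC] with m hm
    exact (ae_restrict_iff' measurableSet_Ioi).2 (ae_of_all _ fun x hx =>
      abs_mul_weight_le hfB (le_of_lt hx) (hm x hx))
  · exact (ae_restrict_iff' measurableSet_Ioi).2 (ae_of_all _ fun x hx =>
      (hlim x hx).mul_const _)

lemma measurable_szaszOperator (u : ℝ → ℝ) : Measurable (szaszOperator m u) :=
  Measurable.tsum fun k => by unfold szaszWeight; fun_prop

/-- Here the measure itself depends on x; writing the integral as a double series makes
measurability in x visible. -/
lemma measurable_szaszSecondMoment (hF1 : ∀ y, |F y| ≤ 1) :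
    Measurable (szaszSecondMoment F m) := by
  have e : szaszSecondMoment F m = fun x => ∑' k : ℕ,
      (Real.exp (-(m * x).toNNReal) * ((m * x).toNNReal : ℝ) ^ k / (Nat.factorial k : ℝ)) •
      ∑' l : ℕ, (Real.exp (-(m * x).toNNReal) * ((m * x).toNNReal : ℝ) ^ l /
        (Nat.factorial l : ℝ)) • F (min ((k : ℝ) / m) ((l : ℝ) / m)) := by
    ext x
    rw [szaszSecondMoment, integral_prod _ (Integrable.of_bound
      (Measurable.of_discrete).aestronglyMeasurable 1 (ae_of_all _ fun _ => hF1 _))]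
    simp only [szaszMeasure, integral_poissonMeasure]
  rw [e]
  refine Measurable.tsum fun k => Measurable.fun_smul (by fun_prop) (Measurable.tsum fun l => ?_)
  fun_prop

lemma abs_szaszSecondMoment_le {x : ℝ} (hF1 : ∀ y, |F y| ≤ 1) : |szaszSecondMoment F m x| ≤ 1 := by
  rw [szaszSecondMoment, ← Real.norm_eq_abs]
  simpa using norm_integral_le_of_norm_le_const
    (μ := (szaszMeasure m x).prod (szaszMeasure m x))
    (f := fun p : ℕ × ℕ => F (min ((p.1 : ℝ) / m) ((p.2 : ℝ) / m))) (ae_of_all _ fun p => hF1 _)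

lemma integrableOn_szaszVariance_mul_weight (ha : 0 < a) (hm : 0 ≤ m) (hF1 : ∀ y, |F y| ≤ 1)
    (hfcont : ContinuousOn f (Ici 0)) (hfB : ∀ x ∈ Ici (0 : ℝ), |f x| ≤ B₀) :
    IntegrableOn (fun x => (szaszSecondMoment F m x - szaszOperator m F x ^ 2) *
      (Real.exp (-(a * x)) * f x)) (Ioi 0) := by
  refine integrableOn_mul_weight (C := 2) ha hfcont hfB
    ((measurable_szaszSecondMoment hF1).sub
      ((measurable_szaszOperator F).pow_const 2)).aestronglyMeasurable fun x hx => ?_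
  have h1 : (1 : ℝ) ≤ (1 + x) ^ 2 := by nlinarith
  have h2 := abs_szaszSecondMoment_le (m := m) (x := x) hF1
  have h3 := pow_le_one₀ (n := 2) (abs_nonneg _) (abs_szaszOperator_le hm hx.le hF1)
  rw [← abs_pow] at h3
  exact (abs_sub _ _).trans (by linarith)

lemma integrableOn_sqBias_mul_weight (ha : 0 < a) (hm : 0 ≤ m) (hFcont : Continuous F)
    (hF1 : ∀ y, |F y| ≤ 1) (hfcont : ContinuousOn f (Ici 0))
    (hfB : ∀ x ∈ Ici (0 : ℝ), |f x| ≤ B₀) :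
    IntegrableOn (fun x => (szaszOperator m F x - F x) ^ 2 *
      (Real.exp (-(a * x)) * f x)) (Ioi 0) := by
  refine integrableOn_mul_weight (g := fun x => (szaszOperator m F x - F x) ^ 2) (C := 4) ha hfcont
    hfB (((measurable_szaszOperator F).sub hFcont.measurable).pow_const 2).aestronglyMeasurable
    fun x hx => ?_
  have h2 : |szaszOperator m F x - F x| ≤ 2 := (abs_sub _ _).trans
    (by linarith [abs_szaszOperator_le hm hx.le hF1, hF1 x])
  rw [abs_pow]
  calc _ ≤ (2 : ℝ) ^ 2 := by gcongr
    _ ≤ 4 * (1 + x) ^ 2 := by nlinarith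

/-- The integrated variance, multiplied by the sample size. -/
noncomputable def szaszIntegratedVariance (F f : ℝ → ℝ) (a m : ℝ) : ℝ :=
  ∫ x in Ioi (0 : ℝ), (szaszSecondMoment F m x - szaszOperator m F x ^ 2) *
    (Real.exp (-(a * x)) * f x)

/-- The integrated squared bias. -/
noncomputable def szaszIntegratedSqBias (F f : ℝ → ℝ) (a m : ℝ) : ℝ :=
  ∫ x in Ioi (0 : ℝ), (szaszOperator m F x - F x) ^ 2 * (Real.exp (-(a * x)) * f x)

/-- Voronovskaya's theorem gives the pointwise limit, and m |S_m F - F| ≤ B x gives the domination.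
-/
lemma tendsto_sq_mul_szaszIntegratedSqBias (ha : 0 < a) (hFcont : Continuous F)
    (hF1 : ∀ y, |F y| ≤ 1)
    (hf : ∀ x ∈ Ici (0 : ℝ), HasDerivWithinAt F (f x) (Ici 0) x)
    (hf' : ∀ x ∈ Ici (0 : ℝ), HasDerivWithinAt f (f' x) (Ici 0) x)
    (hfB : ∀ x ∈ Ici (0 : ℝ), |f x| ≤ B₀) (hB : ∀ x ∈ Ici (0 : ℝ), |f' x| ≤ B) :
    Tendsto (fun m => m ^ 2 * szaszIntegratedSqBias F f a m) atTop (𝓝 (szaszC3 f f' a)) := by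
  have hfcont : ContinuousOn f (Ici 0) := fun x hx => (hf' x hx).continuousWithinAt
  have hB0 : 0 ≤ B := (abs_nonneg _).trans (hB 0 self_mem_Ici)
  have h := tendsto_setIntegral_mul_weight (C := B ^ 2) ha hfcont hfB
    (g := fun m x => (m * (szaszOperator m F x - F x)) ^ 2) (h := fun x => (x * f' x / 2) ^ 2)
    (Eventually.of_forall fun m => (((measurable_szaszOperator F).sub
      hFcont.measurable).const_mul m |>.pow_const 2).aestronglyMeasurable) ?_ ?_
  · refine h.congr fun m => ?_
    rw [szaszIntegratedSqBias, ← integral_const_mul]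
    congr 1; ext x; ring
  · filter_upwards [eventually_gt_atTop 0] with m hm x hx
    have h1 := abs_szaszOperator_sub_le hm hx.le hF1
      (fun y hy => abs_taylor_one_sub_le hf hf' hB hx.le hy)
    have h2 : |m * (szaszOperator m F x - F x)| ≤ B * (1 + x) := by
      rw [abs_mul, abs_of_pos hm]
      calc _ ≤ m * (B * (x / m)) := by gcongr
        _ = B * x := by field_simp
        _ ≤ B * (1 + x) := by gcongr; linarith
    rw [abs_pow, ← mul_pow]
    gcongr
  · intro x hx
    exact (tendsto_mul_szaszOperator_sub hx.le hF1 fun ε hε =>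
      exists_abs_taylor_two_sub_le_add hx.le hε hf hf' hB).pow 2

lemma tendsto_sqrt_mul_szaszIntegratedVariance_sub (ha : 0 < a) (hFcont : Continuous F)
    (hF1 : ∀ y, |F y| ≤ 1)
    (hf : ∀ x ∈ Ici (0 : ℝ), HasDerivWithinAt F (f x) (Ici 0) x)
    (hf' : ∀ x ∈ Ici (0 : ℝ), HasDerivWithinAt f (f' x) (Ici 0) x)
    (hfB : ∀ x ∈ Ici (0 : ℝ), |f x| ≤ B₀) (hB : ∀ x ∈ Ici (0 : ℝ), |f' x| ≤ B) :
    Tendsto (fun m => Real.sqrt m * (szaszIntegratedVariance F f a m - szaszC1 F f a)) atTop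
      (𝓝 (-szaszC2 f a)) := by
  have hfcont : ContinuousOn f (Ici 0) := fun x hx => (hf' x hx).continuousWithinAt
  have hB0 : 0 ≤ B := (abs_nonneg _).trans (hB 0 self_mem_Ici)
  have hB₀ : 0 ≤ B₀ := (abs_nonneg _).trans (hfB 0 self_mem_Ici)
  have hT := fun {x : ℝ} (hx : 0 < x) (y : ℝ) (hy : 0 ≤ y) =>
    abs_taylor_one_sub_le hf hf' hB hx.le hy
  have hmeas : ∀ m, Measurable fun x => szaszSecondMoment F m x - szaszOperator m F x ^ 2 :=
    fun m => (measurable_szaszSecondMoment hF1).sub ((measurable_szaszOperator F).pow_const 2)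
  have hmeasF : Measurable fun x => F x * (1 - F x) := by have := hFcont.measurable; fun_prop
  have h := tendsto_setIntegral_mul_weight (C := B₀ + 4 * B) ha hfcont hfB
    (g := fun m x => Real.sqrt m *
      (szaszSecondMoment F m x - szaszOperator m F x ^ 2 - F x * (1 - F x)))
    (h := fun x => -(f x * Real.sqrt (x / Real.pi)))
    (Eventually.of_forall fun m => (((hmeas m).sub hmeasF).const_mul _).aestronglyMeasurable)
    ?_ (fun x hx => tendsto_sqrt_mul_szaszVariance_sub hx hF1 (hT hx) hB0)
  · simp only [neg_mul, integral_neg] at h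
    refine h.congr' ?_
    filter_upwards [eventually_gt_atTop 0] with m hm
    have h1 : ∀ x : ℝ, 0 < x → (1 : ℝ) ≤ (1 + x) ^ 2 := fun x hx => by nlinarith
    have hi1 := integrableOn_szaszVariance_mul_weight ha hm.le hF1 hfcont hfB
    have hi2 := integrableOn_mul_weight (C := 2) ha hfcont hfB hmeasF.aestronglyMeasurable
      fun x hx => by
        have h2 : |1 - F x| ≤ 2 := (abs_sub _ _).trans (by rw [abs_one]; linarith [hF1 x])
        rw [abs_mul]
        have := mul_le_mul (hF1 x) h2 (abs_nonneg _) zero_le_one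
        linarith [h1 x hx]
    rw [szaszIntegratedVariance, szaszC1, ← integral_sub hi1 hi2, ← integral_const_mul]
    congr 1; ext x; ring
  · filter_upwards [eventually_ge_atTop 1] with m hm x hx
    refine (abs_sqrt_mul_szaszVariance_sub_le hm hx hF1 (hfB x hx.le) (hT hx) hB0).trans ?_
    nlinarith [mul_nonneg hB₀ hx.le, mul_nonneg hB0 hx.le, mul_nonneg hB0 (sq_nonneg x),
      mul_nonneg hB₀ (sq_nonneg x)]

end Weight

/-! ### Variance and bias decomposition of the MISE -/

section MISE

variable {m x : ℝ}

/-- The Szasz-Mirakyan operator applied to `y ↦ 1{z ≤ y}`: the contribution of an observation `z`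
to the Szasz estimator. -/
noncomputable def szaszKernel (m z x : ℝ) : ℝ :=
  szaszOperator m (fun y => (Iic y).indicator (fun _ => (1 : ℝ)) z) x

lemma abs_indicator_one_le (y z : ℝ) : |(Iic y).indicator (fun _ => (1 : ℝ)) z| ≤ 1 := by
  by_cases h : z ∈ Iic y <;> simp [h]

lemma measurable_indicator_Iic_comp {α : Type*} [MeasurableSpace α] {Z : α → ℝ}
    (hZ : Measurable Z) (y : ℝ) : Measurable fun ω => (Iic y).indicator (fun _ => (1 : ℝ)) (Z ω) :=
  (measurable_const.indicator measurableSet_Iic).comp hZ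

lemma abs_szaszKernel_le (hm : 0 ≤ m) (hx : 0 ≤ x) (z : ℝ) : |szaszKernel m z x| ≤ 1 :=
  abs_szaszOperator_le hm hx fun y => abs_indicator_one_le y z

lemma measurable_szaszKernel : Measurable fun p : ℝ × ℝ => szaszKernel m p.1 p.2 := by
  refine Measurable.tsum fun k => Measurable.mul ?_ ?_
  · exact measurable_indicator_Iic_comp measurable_fst _
  · unfold szaszWeight; fun_prop

lemma measurable_szaszKernel_left : Measurable fun z => szaszKernel m z x :=
  measurable_szaszKernel.comp (measurable_id.prodMk measurable_const)

lemma szaszEstimator_eq_sum {Ω : Type*} (X : ℕ → Ω → ℝ) (hm : 0 ≤ m) (hx : 0 ≤ x) (n : ℕ) (ω : Ω) :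
    szaszEstimator X m n ω x = (1 / (n : ℝ)) * ∑ i ∈ Finset.range n, szaszKernel m (X i ω) x := by
  simp only [szaszEstimator, szaszKernel, szaszOperator_eq_integral hm hx, empiricalCDF]
  rw [integral_const_mul, integral_finsetSum]
  exact fun i _ => Integrable.of_bound (Measurable.of_discrete).aestronglyMeasurable 1
    (ae_of_all _ fun k => abs_indicator_one_le _ _)

variable {Ω : Type*} [MeasurableSpace Ω] {P : Measure Ω} [IsProbabilityMeasure P]

lemma integral_indicator_Iic_eq_cdf {Z : Ω → ℝ} (hZ : Measurable Z) (y : ℝ) :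
    ∫ ω, (Iic y).indicator (fun _ => (1 : ℝ)) (Z ω) ∂P = cdf (P.map Z) y := by
  have := Measure.isProbabilityMeasure_map (μ := P) hZ.aemeasurable
  rw [← integral_map (f := (Iic y).indicator (fun _ => (1 : ℝ))) hZ.aemeasurable
    (measurable_const.indicator measurableSet_Iic).aestronglyMeasurable,
    integral_indicator measurableSet_Iic, cdf_eq_real]
  simp

lemma integral_szaszKernel {Z : Ω → ℝ} (hZ : Measurable Z) {F : ℝ → ℝ}
    (hF : ∀ y, F y = cdf (P.map Z) y) (hm : 0 ≤ m) (hx : 0 ≤ x) :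
    ∫ ω, szaszKernel m (Z ω) x ∂P = szaszOperator m F x := by
  simp only [szaszKernel, szaszOperator_eq_integral hm hx]
  rw [integral_integral_swap]
  · simp only [integral_indicator_Iic_eq_cdf hZ, ← hF]
  · refine Integrable.of_bound (Measurable.aestronglyMeasurable ?_) 1
      (ae_of_all _ fun k => abs_indicator_one_le _ _)
    refine measurable_from_prod_countable_left fun k => ?_
    exact measurable_indicator_Iic_comp hZ (k / m)

/-- The square of a Poisson average is an average over two independent copies, and the product of
the indicators of z ≤ u and z ≤ v is that of z ≤ min(u, v). -/
lemma integral_szaszKernel_sq {Z : Ω → ℝ} (hZ : Measurable Z) {F : ℝ → ℝ}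
    (hF : ∀ y, F y = cdf (P.map Z) y) (hm : 0 ≤ m) (hx : 0 ≤ x) :
    ∫ ω, szaszKernel m (Z ω) x ^ 2 ∂P = szaszSecondMoment F m x := by
  have e : ∀ z, szaszKernel m z x ^ 2 =
      ∫ p : ℕ × ℕ, (Iic (min ((p.1 : ℝ) / m) ((p.2 : ℝ) / m))).indicator (fun _ => (1 : ℝ)) z
        ∂((szaszMeasure m x).prod (szaszMeasure m x)) := fun z => by
    rw [szaszKernel, szaszOperator_eq_integral hm hx, sq, ← integral_prod_mul]
    congr 1; ext p
    rw [← Iic_inter_Iic, ← inter_indicator_mul, mul_one]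
  simp only [e]
  rw [integral_integral_swap, szaszSecondMoment]
  · simp only [integral_indicator_Iic_eq_cdf hZ, ← hF]
  · refine Integrable.of_bound (Measurable.aestronglyMeasurable ?_) 1
      (ae_of_all _ fun k => abs_indicator_one_le _ _)
    refine measurable_from_prod_countable_left fun k => ?_
    exact measurable_indicator_Iic_comp hZ (min (k.1 / m) (k.2 / m))

/-- The mean squared error of the Szasz estimator at a point: variance plus squared bias. -/
lemma integral_szaszEstimator_sub_sq {X : ℕ → Ω → ℝ} (hmeas : ∀ i, Measurable (X i))
    (hindep : iIndepFun X P) (hident : ∀ i, IdentDistrib (X i) (X 0) P P) {F : ℝ → ℝ}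
    (hF : ∀ y, F y = cdf (P.map (X 0)) y) (hm : 0 ≤ m) (hx : 0 ≤ x) {n : ℕ} (hn : n ≠ 0) :
    ∫ ω, (szaszEstimator X m n ω x - F x) ^ 2 ∂P =
      (n : ℝ)⁻¹ * (szaszSecondMoment F m x - szaszOperator m F x ^ 2) +
        (szaszOperator m F x - F x) ^ 2 := by
  simp only [szaszEstimator_eq_sum X hm hx]
  set Y : ℕ → Ω → ℝ := fun i ω => szaszKernel m (X i ω) x with hY
  have hYm : ∀ i, Measurable (Y i) := fun i => measurable_szaszKernel_left.comp (hmeas i)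
  have hYL : ∀ i, MemLp (Y i) 2 P := fun i =>
    MemLp.of_bound (hYm i).aestronglyMeasurable 1 (ae_of_all _ fun ω => abs_szaszKernel_le hm hx _)
  have hYid : ∀ i, IdentDistrib (Y i) (Y 0) P P := fun i =>
    (hident i).comp (u := fun z => szaszKernel m z x) measurable_szaszKernel_left
  have hYind : iIndepFun Y P :=
    hindep.comp (fun _ z => szaszKernel m z x) fun _ => measurable_szaszKernel_left
  have hmean : ∀ i, ∫ ω, Y i ω ∂P = szaszOperator m F x := fun i =>
    (hYid i).integral_eq.trans (integral_szaszKernel (hmeas 0) hF hm hx)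
  have hvar : ∀ i, variance (Y i) P = szaszSecondMoment F m x - szaszOperator m F x ^ 2 :=
    fun i => by
      rw [(hYid i).variance_eq, variance_eq_sub (hYL 0), hmean 0]
      simp only [Pi.pow_apply, hY, integral_szaszKernel_sq (hmeas 0) hF hm hx]
  have hn' : (n : ℝ) ≠ 0 := by exact_mod_cast hn
  have hSL : MemLp (∑ i ∈ Finset.range n, Y i) 2 P := memLp_finsetSum' _ fun i _ => hYL i
  set T : Ω → ℝ := fun ω => (1 / (n : ℝ)) * (∑ i ∈ Finset.range n, Y i) ω with hT
  have hTL : MemLp T 2 P := hSL.const_mul _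
  have hTvar : variance T P =
      (n : ℝ)⁻¹ * (szaszSecondMoment F m x - szaszOperator m F x ^ 2) := by
    rw [hT, variance_const_mul, IndepFun.variance_sum (fun i _ => hYL i)
      fun i _ j _ hij => hYind.indepFun hij]
    simp only [hvar, Finset.sum_const, Finset.card_range, nsmul_eq_mul]
    field_simp
  have hTmean : ∫ ω, T ω ∂P = szaszOperator m F x := by
    simp only [hT, Finset.sum_apply]
    rw [integral_const_mul, integral_finsetSum _ fun i _ => (hYL i).integrable one_le_two]
    simp only [hmean, Finset.sum_const, Finset.card_range, nsmul_eq_mul]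
    field_simp
  have hTi : Integrable T P := hTL.integrable one_le_two
  have hmse : ∫ ω, (T ω - F x) ^ 2 ∂P =
      variance T P + (szaszOperator m F x - F x) ^ 2 := by
    have e : ∀ ω, (T ω - F x) ^ 2 = T ω ^ 2 - 2 * F x * T ω + F x ^ 2 := fun ω => by ring
    simp only [e]
    have h1 : Integrable (fun ω => T ω ^ 2) P := hTL.integrable_sq
    have h2 : Integrable (fun ω => 2 * F x * T ω) P := hTi.const_mul _
    have h3 : Integrable (fun ω => T ω ^ 2 - 2 * F x * T ω) P := h1.sub h2
    rw [variance_eq_sub hTL, integral_add h3 (integrable_const _), integral_sub h1 h2,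
      integral_const_mul, hTmean]
    simp
    ring
  rw [← hTvar, ← hmse]
  simp [hT, hY]

lemma szaszMISE_eq {X : ℕ → Ω → ℝ} (hmeas : ∀ i, Measurable (X i))
    (hindep : iIndepFun X P) (hident : ∀ i, IdentDistrib (X i) (X 0) P P) {F f : ℝ → ℝ}
    (hF : ∀ y, F y = cdf (P.map (X 0)) y) (hFcont : Continuous F) (hF1 : ∀ y, |F y| ≤ 1)
    (hfcont : ContinuousOn f (Ici 0)) {B₀ : ℝ} (hfB : ∀ x ∈ Ici (0 : ℝ), |f x| ≤ B₀)
    {a : ℝ} (ha : 0 < a) (hm : 0 < m) {n : ℕ} (hn : n ≠ 0) :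
    szaszMISE P X F f a m n =
      (n : ℝ)⁻¹ * szaszIntegratedVariance F f a m + szaszIntegratedSqBias F f a m := by
  have h1 : ∀ x : ℝ, 0 < x → (1 : ℝ) ≤ (1 + x) ^ 2 := fun x hx => by nlinarith
  have hest : ∀ ω x, 0 < x → |szaszEstimator X m n ω x| ≤ 1 := fun ω x hx => by
    refine abs_szaszOperator_le hm.le hx.le fun y => ?_
    rw [empiricalCDF, abs_mul, abs_of_nonneg (by positivity), one_div,
      inv_mul_le_iff₀ (by positivity), mul_one]
    refine (Finset.abs_sum_le_sum_abs _ _).trans ?_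
    simpa using Finset.sum_le_card_nsmul (Finset.range n) _ (1 : ℝ)
      fun i _ => abs_indicator_one_le y (X i ω)
  have hemp : ∀ y, Measurable fun ω => empiricalCDF X n ω y := fun y =>
    (Finset.measurable_fun_sum _ fun i _ =>
      measurable_indicator_Iic_comp (hmeas i) y).const_mul _
  have hestm : Measurable fun p : Ω × ℝ => szaszEstimator X m n p.1 p.2 := by
    refine Measurable.tsum fun k => Measurable.mul ((hemp _).comp measurable_fst) ?_
    unfold szaszWeight; fun_prop
  have hint : Integrable (Function.uncurry fun (ω : Ω) (x : ℝ) =>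
      (szaszEstimator X m n ω x - F x) ^ 2 * (Real.exp (-(a * x)) * f x))
      (P.prod (volume.restrict (Ioi 0))) := by
    refine Integrable.mono' (((integrableOn_one_add_sq_mul_exp ha).const_mul (4 * B₀)).comp_snd P)
      ((((hestm.sub (hFcont.measurable.comp measurable_snd)).pow_const 2).aestronglyMeasurable).mul
        (aestronglyMeasurable_weight hfcont).comp_snd) ?_
    filter_upwards [Measure.quasiMeasurePreserving_snd.ae
      (ae_restrict_mem (μ := volume) (measurableSet_Ioi (a := (0 : ℝ))))] with p hp
    refine abs_mul_weight_le hfB (le_of_lt hp) ?_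
    have h2 : |szaszEstimator X m n p.1 p.2 - F p.2| ≤ 2 := (abs_sub _ _).trans
      (by linarith [hest p.1 p.2 hp, hF1 p.2])
    rw [abs_pow]
    calc _ ≤ (2 : ℝ) ^ 2 := by gcongr
      _ ≤ 4 * (1 + p.2) ^ 2 := by linarith [h1 p.2 hp]
  rw [szaszMISE, integral_integral_swap hint]
  have hi1 := integrableOn_szaszVariance_mul_weight ha hm.le hF1 hfcont hfB
  have hi2 := integrableOn_sqBias_mul_weight ha hm.le hFcont hF1 hfcont hfB
  rw [szaszIntegratedVariance, szaszIntegratedSqBias, ← integral_const_mul,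
    ← integral_add (hi1.const_mul _) hi2]
  refine setIntegral_congr_fun measurableSet_Ioi fun x hx => ?_
  rw [integral_mul_const, integral_szaszEstimator_sub_sq hmeas hindep hident hF hm.le
    (le_of_lt hx) hn]
  ring

end MISE

/-! ### Minimisation of a variance plus bias criterion -/

section Optimality

/-- The first order optimality gap: `s⁴ - 4 s` is minimal on `[0, ∞)` exactly at `s = 1`. -/
lemma three_mul_sub_one_sq_le {s : ℝ} (hs : 0 ≤ s) : 3 * (s - 1) ^ 2 ≤ s ^ 4 - 4 * s + 3 := by
  have : s ^ 4 - 4 * s + 3 = (s - 1) ^ 2 * (s ^ 2 + 2 * s + 3) := by ring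
  rw [this]
  nlinarith [mul_nonneg (sq_nonneg (s - 1)) (by positivity : 0 ≤ s ^ 2 + 2 * s)]

/-- Lets the gap absorb the error terms o(1) s and o(1) s⁴ without any bound on s. -/
lemma add_pow_four_le (s : ℝ) : s + s ^ 4 ≤ 2 * (s ^ 4 - 4 * s + 3) + 10 := by
  nlinarith [sq_nonneg (s ^ 2 - 2), sq_nonneg (4 * s - 9 / 2)]

variable {M : ℝ → ℕ → ℝ} {V b : ℝ → ℝ} {C₁ C₂ C₃ c : ℝ} {m : ℕ → ℝ}

/-- The rescaled excess of the criterion over its optimal value, as a function of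
`s = √(m_opt / m)`. -/
lemma rescaled_excess_eq {n : ℕ} {x : ℝ} (hn : n ≠ 0) (hx : 0 < x) (hc : 0 < c)
    (hC₃ : 4 * C₃ = c * C₂)
    (hM : M x n = (n : ℝ)⁻¹ * V x + b x) :
    (n : ℝ) ^ ((4 : ℝ) / 3) * (M x n - (n : ℝ)⁻¹ * C₁) + 3 * C₃ * c ^ (-(4 : ℝ) / 3) =
      c ^ (-(4 : ℝ) / 3) * (C₃ * (Real.sqrt ((n : ℝ) ^ ((2 : ℝ) / 3) * c ^ ((2 : ℝ) / 3) / x) ^ 4 -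
          4 * Real.sqrt ((n : ℝ) ^ ((2 : ℝ) / 3) * c ^ ((2 : ℝ) / 3) / x) + 3) +
        c * (Real.sqrt x * (V x - C₁) + C₂) *
          Real.sqrt ((n : ℝ) ^ ((2 : ℝ) / 3) * c ^ ((2 : ℝ) / 3) / x) +
        (x ^ 2 * b x - C₃) *
          Real.sqrt ((n : ℝ) ^ ((2 : ℝ) / 3) * c ^ ((2 : ℝ) / 3) / x) ^ 4) := by
  have hn0 : (0 : ℝ) < n := by exact_mod_cast Nat.pos_of_ne_zero hn
  -- In terms of n^{1/3}, c^{1/3} and √x every fractional power is a monomial, and the claim becomes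
  -- a rational identity.
  obtain ⟨p, hp, hpn⟩ : ∃ p : ℝ, 0 < p ∧ p = (n : ℝ) ^ ((1 : ℝ) / 3) :=
    ⟨_, Real.rpow_pos_of_pos hn0 _, rfl⟩
  obtain ⟨q, hq, hqc⟩ : ∃ q : ℝ, 0 < q ∧ q = c ^ ((1 : ℝ) / 3) :=
    ⟨_, Real.rpow_pos_of_pos hc _, rfl⟩
  obtain ⟨y, hy, hyx⟩ : ∃ y : ℝ, 0 < y ∧ y = Real.sqrt x := ⟨_, Real.sqrt_pos.2 hx, rfl⟩
  have e1 : (n : ℝ) ^ ((2 : ℝ) / 3) = p ^ 2 := by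
    rw [hpn, ← Real.rpow_mul_natCast hn0.le]; norm_num
  have e2 : (n : ℝ) ^ ((4 : ℝ) / 3) = p ^ 4 := by
    rw [hpn, ← Real.rpow_mul_natCast hn0.le]; norm_num
  have e3 : (n : ℝ) = p ^ 3 := by
    rw [hpn, ← Real.rpow_mul_natCast hn0.le]; norm_num
  have e4 : c ^ ((2 : ℝ) / 3) = q ^ 2 := by
    rw [hqc, ← Real.rpow_mul_natCast hc.le]; norm_num
  have e5 : c ^ (-(4 : ℝ) / 3) = (q ^ 4)⁻¹ := by
    rw [hqc, ← Real.rpow_mul_natCast hc.le, ← Real.rpow_neg hc.le]; norm_num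
  have e6 : c = q ^ 3 := by
    rw [hqc, ← Real.rpow_mul_natCast hc.le]; norm_num
  have e7 : x = y ^ 2 := by rw [hyx, Real.sq_sqrt hx.le]
  have e8 : Real.sqrt ((n : ℝ) ^ ((2 : ℝ) / 3) * c ^ ((2 : ℝ) / 3) / x) = p * q / y := by
    rw [e1, e4, e7, show p ^ 2 * q ^ 2 / y ^ 2 = (p * q / y) ^ 2 by ring,
      Real.sqrt_sq (by positivity)]
  have hC : C₂ = 4 * C₃ / q ^ 3 := by
    rw [eq_div_iff (by positivity), ← e6]; linarith
  rw [e8, e2, e5, hM, ← hyx, hC]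
  -- Shields the arguments of `V` and `b` from the rewriting of x as y².
  generalize V x = v
  generalize b x = β
  rw [e3, e6, e7]
  field_simp
  ring

/-- The optimal smoothing parameter for the criterion `C₁ / n - C₂ n⁻¹ x^{-1/2} + C₃ x⁻²`. -/
noncomputable def optimalSmoothing (C₂ C₃ : ℝ) (n : ℕ) : ℝ :=
  (n : ℝ) ^ ((2 : ℝ) / 3) * (4 * C₃ / C₂) ^ ((2 : ℝ) / 3)

/-- A criterion `M x n = V x / n + b x` with the expansions `V x = C₁ - C₂ x^{-1/2} + o(x^{-1/2})`
and `b x = C₃ x⁻² + o(x⁻²)`. -/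
structure IsVarianceBiasCriterion (M : ℝ → ℕ → ℝ) (V b : ℝ → ℝ) (C₁ C₂ C₃ : ℝ) : Prop where
  pos_variance : 0 < C₂
  pos_bias : 0 < C₃
  eq : ∀ x : ℝ, 0 < x → ∀ n : ℕ, n ≠ 0 → M x n = (n : ℝ)⁻¹ * V x + b x
  variance : Tendsto (fun x => Real.sqrt x * (V x - C₁)) atTop (𝓝 (-C₂))
  bias : Tendsto (fun x => x ^ 2 * b x) atTop (𝓝 C₃)

/-- The excess of the criterion over its optimal value, multiplied by `n^{4/3}`. -/
noncomputable def rescaledExcess (M : ℝ → ℕ → ℝ) (C₁ C₂ C₃ x : ℝ) (n : ℕ) : ℝ :=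
  (n : ℝ) ^ ((4 : ℝ) / 3) * (M x n - (n : ℝ)⁻¹ * C₁) +
    3 * C₃ * (4 * C₃ / C₂) ^ (-(4 : ℝ) / 3)

lemma tendsto_optimalSmoothing (hC₂ : 0 < C₂) (hC₃ : 0 < C₃) :
    Tendsto (optimalSmoothing C₂ C₃) atTop atTop :=
  ((tendsto_rpow_atTop (by norm_num)).comp tendsto_natCast_atTop_atTop).atTop_mul_const
    (Real.rpow_pos_of_pos (by positivity) _)

/-- Multiplication by n^{4/3} turns the tolerance ε n^{-4/3} of optimality into a fixed ε. -/
lemma rescaledExcess_le_add_iff {x y ε : ℝ} {n : ℕ} (hn : n ≠ 0) :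
    rescaledExcess M C₁ C₂ C₃ x n ≤ rescaledExcess M C₁ C₂ C₃ y n + ε ↔
      M x n ≤ M y n + ε * (n : ℝ) ^ (-(4 : ℝ) / 3) := by
  have hn0 : (0 : ℝ) < n := by exact_mod_cast Nat.pos_of_ne_zero hn
  have hp : 0 < (n : ℝ) ^ ((4 : ℝ) / 3) := Real.rpow_pos_of_pos hn0 _
  rw [rescaledExcess, rescaledExcess, neg_div, Real.rpow_neg hn0.le,
    ← mul_le_mul_iff_right₀ hp (b := M x n), mul_add, mul_left_comm _ ε,
    mul_inv_cancel₀ hp.ne', mul_one]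
  constructor <;> intro h <;> nlinarith

lemma isLittleO_iff_tendsto_rescaledExcess (hC₂ : 0 < C₂) (hC₃ : 0 < C₃) :
    ((fun n : ℕ => M (m n) n - ((n : ℝ)⁻¹ * C₁ - (3 / 4) * (n : ℝ) ^ (-(4 : ℝ) / 3) *
          (C₂ ^ 4 / (4 * C₃)) ^ ((1 : ℝ) / 3))) =o[atTop]
        (fun n : ℕ => (n : ℝ) ^ (-(4 : ℝ) / 3))) ↔
      Tendsto (fun n => rescaledExcess M C₁ C₂ C₃ (m n) n) atTop (𝓝 0) := by
  -- With q³ = 4C₃/C₂ both sides equal (3/4) C₂/q.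
  have hconst : 3 * C₃ * (4 * C₃ / C₂) ^ (-(4 : ℝ) / 3) =
      3 / 4 * (C₂ ^ 4 / (4 * C₃)) ^ ((1 : ℝ) / 3) := by
    obtain ⟨q, hq, hqc⟩ : ∃ q : ℝ, 0 < q ∧ q = (4 * C₃ / C₂) ^ ((1 : ℝ) / 3) :=
      ⟨_, Real.rpow_pos_of_pos (by positivity) _, rfl⟩
    have e6 : 4 * C₃ / C₂ = q ^ 3 := by
      rw [hqc, ← Real.rpow_mul_natCast (by positivity)]; norm_num
    have e5 : (4 * C₃ / C₂) ^ (-(4 : ℝ) / 3) = (q ^ 4)⁻¹ := by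
      rw [hqc, ← Real.rpow_mul_natCast (by positivity), ← Real.rpow_neg (by positivity)]; norm_num
    have hC : 4 * C₃ = C₂ * q ^ 3 := by rw [← e6]; field_simp
    have e7 : C₂ ^ 4 / (4 * C₃) = (C₂ / q) ^ 3 := by rw [hC]; field_simp
    rw [e5, e7, ← Real.rpow_natCast_mul (by positivity)]
    norm_num
    field_simp
    linarith
  rw [isLittleO_iff_tendsto']
  · refine tendsto_congr' ?_
    filter_upwards [eventually_ne_atTop 0] with n hn
    have hn0 : (0 : ℝ) < n := by exact_mod_cast Nat.pos_of_ne_zero hn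
    have hp : 0 < (n : ℝ) ^ ((4 : ℝ) / 3) := Real.rpow_pos_of_pos hn0 _
    rw [rescaledExcess, hconst, neg_div, Real.rpow_neg hn0.le]
    field_simp
    ring
  · filter_upwards [eventually_ne_atTop 0] with n hn h
    have hn0 : (0 : ℝ) < n := by exact_mod_cast Nat.pos_of_ne_zero hn
    exact absurd h (Real.rpow_pos_of_pos hn0 _).ne'

namespace IsVarianceBiasCriterion

lemma rescaledExcess_eq (h : IsVarianceBiasCriterion M V b C₁ C₂ C₃) {x : ℝ} (hx : 0 < x) {n : ℕ}
    (hn : n ≠ 0) :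
    rescaledExcess M C₁ C₂ C₃ x n = (4 * C₃ / C₂) ^ (-(4 : ℝ) / 3) *
      (C₃ * (Real.sqrt (optimalSmoothing C₂ C₃ n / x) ^ 4 -
          4 * Real.sqrt (optimalSmoothing C₂ C₃ n / x) + 3) +
        4 * C₃ / C₂ * (Real.sqrt x * (V x - C₁) + C₂) *
          Real.sqrt (optimalSmoothing C₂ C₃ n / x) +
        (x ^ 2 * b x - C₃) * Real.sqrt (optimalSmoothing C₂ C₃ n / x) ^ 4) := by
  have hC₂ := h.pos_variance
  have hC₃ := h.pos_bias
  exact rescaled_excess_eq hn hx (by positivity) (by field_simp) (h.eq x hx n hn)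

lemma tendsto_variance_error (h : IsVarianceBiasCriterion M V b C₁ C₂ C₃)
    (hm : Tendsto m atTop atTop) :
    Tendsto (fun n => 4 * C₃ / C₂ * (Real.sqrt (m n) * (V (m n) - C₁) + C₂)) atTop (𝓝 0) := by
  simpa using ((h.variance.comp hm).add_const C₂).const_mul (4 * C₃ / C₂)

lemma tendsto_bias_error (h : IsVarianceBiasCriterion M V b C₁ C₂ C₃)
    (hm : Tendsto m atTop atTop) :
    Tendsto (fun n => m n ^ 2 * b (m n) - C₃) atTop (𝓝 0) := by
  simpa using (h.bias.comp hm).sub_const C₃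

lemma tendsto_rescaledExcess (h : IsVarianceBiasCriterion M V b C₁ C₂ C₃)
    (hm : m ~[atTop] optimalSmoothing C₂ C₃) :
    Tendsto (fun n => rescaledExcess M C₁ C₂ C₃ (m n) n) atTop (𝓝 0) := by
  have hopt := tendsto_optimalSmoothing h.pos_variance h.pos_bias
  have hmtop : Tendsto m atTop atTop := hm.symm.tendsto_atTop hopt
  have hs : Tendsto (fun n => Real.sqrt (optimalSmoothing C₂ C₃ n / m n)) atTop (𝓝 1) := by
    have := (isEquivalent_iff_tendsto_one (by
      filter_upwards [hmtop.eventually_gt_atTop 0] with n hn using hn.ne')).1 hm.symm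
    simpa using this.sqrt
  have hlim := (((((hs.pow 4).sub (hs.const_mul 4)).add_const 3).const_mul C₃).add
    ((h.tendsto_variance_error hmtop).mul hs)).add
    ((h.tendsto_bias_error hmtop).mul (hs.pow 4)) |>.const_mul ((4 * C₃ / C₂) ^ (-(4 : ℝ) / 3))
  norm_num at hlim
  refine Tendsto.congr' ?_ hlim
  filter_upwards [hmtop.eventually_gt_atTop 0, eventually_ne_atTop 0] with n h1 h2
  rw [h.rescaledExcess_eq h1 h2]
  norm_num

/-- Both error factors eventually exceed -η, so the errors cost at most η (s + s⁴), which
`add_pow_four_le` trades for a multiple of the gap and a constant. -/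
lemma eventually_le_rescaledExcess (h : IsVarianceBiasCriterion M V b C₁ C₂ C₃)
    (hm : Tendsto m atTop atTop) {η : ℝ} (hη : 0 < η) :
    ∀ᶠ n in atTop, (4 * C₃ / C₂) ^ (-(4 : ℝ) / 3) *
      ((C₃ - 2 * η) * (Real.sqrt (optimalSmoothing C₂ C₃ n / m n) ^ 4 -
          4 * Real.sqrt (optimalSmoothing C₂ C₃ n / m n) + 3) - 10 * η) ≤
      rescaledExcess M C₁ C₂ C₃ (m n) n := by
  have hC₂ := h.pos_variance
  have hC₃ := h.pos_bias
  filter_upwards [hm.eventually_gt_atTop 0, eventually_ne_atTop 0,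
    (h.tendsto_variance_error hm).eventually (lt_mem_nhds (neg_lt_zero.2 hη)),
    (h.tendsto_bias_error hm).eventually (lt_mem_nhds (neg_lt_zero.2 hη))] with n h1 h2 h3 h4
  rw [h.rescaledExcess_eq h1 h2]
  refine mul_le_mul_of_nonneg_left ?_ (Real.rpow_nonneg (by positivity) _)
  have hs := Real.sqrt_nonneg (optimalSmoothing C₂ C₃ n / m n)
  set s := Real.sqrt (optimalSmoothing C₂ C₃ n / m n)
  have h5 := mul_le_mul_of_nonneg_right h3.le hs
  have h6 := mul_le_mul_of_nonneg_right h4.le (by positivity : 0 ≤ s ^ 4)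
  have h7 := mul_le_mul_of_nonneg_left (add_pow_four_le s) hη.le
  linarith

lemma eventually_neg_le_rescaledExcess (h : IsVarianceBiasCriterion M V b C₁ C₂ C₃)
    (hm : Tendsto m atTop atTop) {ε : ℝ} (hε : 0 < ε) :
    ∀ᶠ n in atTop, -ε ≤ rescaledExcess M C₁ C₂ C₃ (m n) n := by
  have hC₂ := h.pos_variance
  have hC₃ := h.pos_bias
  have hK : 0 < (4 * C₃ / C₂) ^ (-(4 : ℝ) / 3) := Real.rpow_pos_of_pos (by positivity) _
  set K := (4 * C₃ / C₂) ^ (-(4 : ℝ) / 3) with hKdef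
  -- The first bound on η keeps the coefficient of the gap nonnegative; the second makes the
  -- constant loss 10ηK at most ε.
  filter_upwards [h.eventually_le_rescaledExcess hm
    (η := min (C₃ / 2) (ε / (10 * K))) (by positivity)] with n hn
  refine le_trans ?_ hn
  rw [← hKdef]
  have h1 : min (C₃ / 2) (ε / (10 * K)) ≤ C₃ / 2 := min_le_left _ _
  have h2 : min (C₃ / 2) (ε / (10 * K)) ≤ ε / (10 * K) := min_le_right _ _
  set η := min (C₃ / 2) (ε / (10 * K))
  have h3 := three_mul_sub_one_sq_le (Real.sqrt_nonneg (optimalSmoothing C₂ C₃ n / m n))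
  set G := Real.sqrt (optimalSmoothing C₂ C₃ n / m n) ^ 4 -
    4 * Real.sqrt (optimalSmoothing C₂ C₃ n / m n) + 3
  have hG : 0 ≤ G := le_trans (by positivity) h3
  have h4 : 0 ≤ (C₃ - 2 * η) * G := mul_nonneg (by linarith) hG
  calc -ε = K * (-(10 * (ε / (10 * K)))) := by field_simp
    _ ≤ K * ((C₃ - 2 * η) * G - 10 * η) := mul_le_mul_of_nonneg_left (by linarith) hK.le

lemma isAsymptoticallyOptimal_of_isEquivalent (h : IsVarianceBiasCriterion M V b C₁ C₂ C₃)
    (hm : m ~[atTop] optimalSmoothing C₂ C₃) :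
    IsAsymptoticallyOptimal M (fun n => (n : ℝ) ^ (-(4 : ℝ) / 3)) m := by
  refine ⟨hm.symm.tendsto_atTop (tendsto_optimalSmoothing h.pos_variance h.pos_bias),
    fun m' hm' ε hε => ?_⟩
  filter_upwards [eventually_ne_atTop 0, h.eventually_neg_le_rescaledExcess hm' (half_pos hε),
    (h.tendsto_rescaledExcess hm).eventually (gt_mem_nhds (half_pos hε))] with n hn h1 h2
  rw [← rescaledExcess_le_add_iff (C₁ := C₁) (C₂ := C₂) (C₃ := C₃) hn]
  linarith

/-- Comparison with `optimalSmoothing` makes the excess of `m` eventually small; the lower bound by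
the gap then forces s → 1. -/
lemma isEquivalent_of_isAsymptoticallyOptimal (h : IsVarianceBiasCriterion M V b C₁ C₂ C₃)
    (hm : IsAsymptoticallyOptimal M (fun n => (n : ℝ) ^ (-(4 : ℝ) / 3)) m) :
    m ~[atTop] optimalSmoothing C₂ C₃ := by
  have hC₂ := h.pos_variance
  have hC₃ := h.pos_bias
  obtain ⟨hmtop, hopt⟩ := hm
  have hotop := tendsto_optimalSmoothing hC₂ hC₃
  have hK : 0 < (4 * C₃ / C₂) ^ (-(4 : ℝ) / 3) := Real.rpow_pos_of_pos (by positivity) _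
  have hs : Tendsto (fun n => Real.sqrt (optimalSmoothing C₂ C₃ n / m n)) atTop (𝓝 1) := by
    rw [Metric.tendsto_nhds]
    intro δ hδ
    set K := (4 * C₃ / C₂) ^ (-(4 : ℝ) / 3) with hKdef
    -- With this ε and the η below, the gap is below (3/2) δ². Less than 3δ² would do, since the gap
    -- is at least 3 (s - 1)².
    set ε := K * (C₃ * δ ^ 2 / 4) with hε
    have hε0 : 0 < ε := by positivity
    have hη0 : 0 < min (C₃ / 4) (C₃ * δ ^ 2 / 20) := by positivity
    filter_upwards [h.eventually_le_rescaledExcess hmtop hη0, eventually_ne_atTop 0,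
      hopt _ hotop (ε / 2) (half_pos hε0),
      (h.tendsto_rescaledExcess IsEquivalent.refl).eventually (gt_mem_nhds (half_pos hε0))]
      with n h1 h2 h3 h4
    rw [← rescaledExcess_le_add_iff (C₁ := C₁) (C₂ := C₂) (C₃ := C₃) h2] at h3
    rw [← hKdef] at h1
    have h5 : min (C₃ / 4) (C₃ * δ ^ 2 / 20) ≤ C₃ / 4 := min_le_left _ _
    have h6 : min (C₃ / 4) (C₃ * δ ^ 2 / 20) ≤ C₃ * δ ^ 2 / 20 := min_le_right _ _
    set η := min (C₃ / 4) (C₃ * δ ^ 2 / 20)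
    have h7 := three_mul_sub_one_sq_le (Real.sqrt_nonneg (optimalSmoothing C₂ C₃ n / m n))
    set s := Real.sqrt (optimalSmoothing C₂ C₃ n / m n)
    have h8 : K * ((C₃ - 2 * η) * (s ^ 4 - 4 * s + 3) - 10 * η) < K * (C₃ * δ ^ 2 / 4) := by
      linarith
    have h9 := lt_of_mul_lt_mul_left h8 hK.le
    have hG : 0 ≤ s ^ 4 - 4 * s + 3 := le_trans (by positivity) h7
    have h10 : C₃ / 2 * (s ^ 4 - 4 * s + 3) ≤ (C₃ - 2 * η) * (s ^ 4 - 4 * s + 3) :=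
      mul_le_mul_of_nonneg_right (by linarith) hG
    have h11 : C₃ * (s ^ 4 - 4 * s + 3) < C₃ * (3 * δ ^ 2) := by nlinarith
    have h12 := lt_of_mul_lt_mul_left h11 hC₃.le
    rw [Real.dist_eq]
    exact abs_lt_of_sq_lt_sq (by linarith) hδ.le
  refine IsEquivalent.symm ((isEquivalent_iff_tendsto_one (by
    filter_upwards [hmtop.eventually_gt_atTop 0] with n hn using hn.ne')).2 ?_)
  have := hs.pow 2
  rw [one_pow] at this
  refine this.congr' ?_
  filter_upwards [hmtop.eventually_gt_atTop 0, hotop.eventually_gt_atTop 0] with n h1 h2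
  rw [Real.sq_sqrt (div_pos h2 h1).le, Pi.div_apply]

end IsVarianceBiasCriterion

end Optimality

/-! ### Positivity of the constants -/

section Positivity

variable {F f f' : ℝ → ℝ} {B B₀ a : ℝ}

lemma setIntegral_Ioi_pos_of_continuousOn {g : ℝ → ℝ} (hg : ContinuousOn g (Ioi 0))
    (hint : IntegrableOn g (Ioi 0)) (hnn : ∀ x, 0 < x → 0 ≤ g x) {x₀ : ℝ} (hx₀ : 0 < x₀)
    (hgx₀ : g x₀ ≠ 0) : 0 < ∫ x in Ioi (0 : ℝ), g x := by
  rw [setIntegral_pos_iff_support_of_nonneg_ae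
    ((ae_restrict_iff' measurableSet_Ioi).2 (ae_of_all _ hnn)) hint]
  have hopen : IsOpen (Ioi (0 : ℝ) ∩ g ⁻¹' {0}ᶜ) :=
    hg.isOpen_inter_preimage isOpen_Ioi isOpen_compl_singleton
  refine (hopen.measure_pos volume ⟨x₀, hx₀, hgx₀⟩).trans_le (measure_mono fun x hx => ?_)
  exact ⟨hx.2, hx.1⟩

lemma nonneg_of_hasDerivWithinAt_of_monotone (hmono : Monotone F)
    (hf : ∀ x ∈ Ici (0 : ℝ), HasDerivWithinAt F (f x) (Ici 0) x) {x : ℝ} (hx : 0 < x) :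
    0 ≤ f x := by
  have h := (hf x hx.le).hasDerivAt (Ici_mem_nhds hx)
  rw [← h.deriv]
  exact hmono.deriv_nonneg

/-- A distribution on the half line cannot have a density whose derivative vanishes wherever the
density does not. -/
lemma exists_deriv_mul_ne_zero (hmono : Monotone F) (hFcont : Continuous F) (hF0 : F 0 = 0)
    (hF1 : ∀ y, |F y| ≤ 1) (hFtop : Tendsto F atTop (𝓝 1))
    (hf : ∀ x ∈ Ici (0 : ℝ), HasDerivWithinAt F (f x) (Ici 0) x)
    (hf' : ∀ x ∈ Ici (0 : ℝ), HasDerivWithinAt f (f' x) (Ici 0) x) :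
    ∃ x, 0 < x ∧ f x ≠ 0 ∧ f' x ≠ 0 := by
  by_contra! hcon
  have hzero : ∀ x, 0 < x → f x * f' x = 0 := fun x hx => by
    by_cases h : f x = 0
    · simp [h]
    · simp [hcon x hx h]
  -- f² has derivative 2 f f' = 0 and f ≥ 0, so f is constant and F is affine on the open half line.
  have hsq : ∀ x, 0 < x → f x = f 1 := fun x hx => by
    have hd : ∀ y ∈ Ioi (0 : ℝ), HasDerivWithinAt (fun z => f z ^ 2) 0 (Ioi 0) y := fun y hy => by
      convert! ((hf' y (Ioi_subset_Ici_self hy)).mono Ioi_subset_Ici_self).pow 2 using 1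
      have := hzero y hy
      norm_num
      simpa [mul_assoc] using this
    have h1 := (convex_Ioi (0 : ℝ)).norm_image_sub_le_of_norm_hasDerivWithin_le (C := 0) hd
      (fun y _ => by simp) (mem_Ioi.2 one_pos) hx
    rw [zero_mul, norm_le_zero_iff, sub_eq_zero] at h1
    exact (sq_eq_sq₀ (nonneg_of_hasDerivWithinAt_of_monotone hmono hf hx)
      (nonneg_of_hasDerivWithinAt_of_monotone hmono hf one_pos)).1 h1
  have haff : ∀ x, 0 < x → F x = F 1 + f 1 * (x - 1) := fun x hx => by
    have hd : ∀ y ∈ Ioi (0 : ℝ), HasDerivWithinAt (fun z => F z - f 1 * z) 0 (Ioi 0) y :=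
      fun y hy => by
        convert! ((hf y (Ioi_subset_Ici_self hy)).mono Ioi_subset_Ici_self).sub
          ((hasDerivWithinAt_id y _).const_mul (f 1)) using 1
        rw [hsq y hy]; ring
    have h1 := (convex_Ioi (0 : ℝ)).norm_image_sub_le_of_norm_hasDerivWithin_le (C := 0) hd
      (fun y _ => by simp) (mem_Ioi.2 one_pos) hx
    rw [zero_mul, norm_le_zero_iff] at h1
    linarith
  have hf1 : 0 ≤ f 1 := nonneg_of_hasDerivWithinAt_of_monotone hmono hf one_pos
  -- Slope zero makes F constant, against F(0) = 0 and the limit 1 at infinity. A positive slope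
  -- raises F by 3 between 1 and 1 + 3/f(1), against |F| ≤ 1.
  rcases hf1.eq_or_lt with h | h
  · have hconst : ∀ x, 0 < x → F x = F 1 := fun x hx => by rw [haff x hx, ← h]; ring
    have h1 : F 1 = 1 := tendsto_nhds_unique (tendsto_const_nhds.congr' (by
      filter_upwards [eventually_gt_atTop 0] with x hx using (hconst x hx).symm)) hFtop
    have h0 : F 1 = F 0 := tendsto_nhds_unique (tendsto_const_nhds.congr' (by
      filter_upwards [self_mem_nhdsWithin] with x hx using (hconst x hx).symm))
      (hFcont.continuousAt.mono_left (nhdsWithin_le_nhds (s := Ioi (0 : ℝ))))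
    linarith
  · have h1 := haff (1 + 3 / f 1) (by positivity)
    rw [add_sub_cancel_left, mul_div_cancel₀ _ h.ne'] at h1
    have h2 := abs_le.1 (hF1 (1 + 3 / f 1))
    have h3 := abs_le.1 (hF1 1)
    linarith

lemma szaszC3_pos (ha : 0 < a) (hmono : Monotone F)
    (hf : ∀ x ∈ Ici (0 : ℝ), HasDerivWithinAt F (f x) (Ici 0) x)
    (hfcont : ContinuousOn f (Ici 0)) (hf'cont : ContinuousOn f' (Ici 0))
    (hfB : ∀ x ∈ Ici (0 : ℝ), |f x| ≤ B₀) (hB : ∀ x ∈ Ici (0 : ℝ), |f' x| ≤ B)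
    {x₀ : ℝ} (hx₀ : 0 < x₀) (hf0 : f x₀ ≠ 0) (hf'0 : f' x₀ ≠ 0) : 0 < szaszC3 f f' a := by
  have hfc := hfcont.mono Ioi_subset_Ici_self
  have hf'c := hf'cont.mono Ioi_subset_Ici_self
  have hc : ContinuousOn (fun x => (x * f' x / 2) ^ 2) (Ioi 0) := by fun_prop
  refine setIntegral_Ioi_pos_of_continuousOn (x₀ := x₀) (by fun_prop)
    (integrableOn_mul_weight (C := B ^ 2) ha hfcont hfB
      (hc.aestronglyMeasurable measurableSet_Ioi) fun x hx => ?_) (fun x hx => ?_) hx₀ ?_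
  · rw [abs_pow, ← mul_pow, abs_div, abs_mul, abs_of_pos hx, abs_two]
    have := hB x hx.le
    have h0 := abs_nonneg (f' x)
    gcongr
    rw [div_le_iff₀ (by norm_num)]
    nlinarith
  · have := nonneg_of_hasDerivWithinAt_of_monotone hmono hf hx
    positivity
  · have : Real.exp (-(a * x₀)) ≠ 0 := (Real.exp_pos _).ne'
    have := hx₀.ne'
    positivity

lemma szaszC2_pos (ha : 0 < a) (hmono : Monotone F)
    (hf : ∀ x ∈ Ici (0 : ℝ), HasDerivWithinAt F (f x) (Ici 0) x)
    (hfcont : ContinuousOn f (Ici 0)) (hfB : ∀ x ∈ Ici (0 : ℝ), |f x| ≤ B₀)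
    {x₀ : ℝ} (hx₀ : 0 < x₀) (hf0 : f x₀ ≠ 0) : 0 < szaszC2 f a := by
  have hfc := hfcont.mono Ioi_subset_Ici_self
  have hc : ContinuousOn (fun x => f x * Real.sqrt (x / Real.pi)) (Ioi 0) := by fun_prop
  refine setIntegral_Ioi_pos_of_continuousOn (x₀ := x₀) (by fun_prop)
    (integrableOn_mul_weight (C := B₀) ha hfcont hfB
      (hc.aestronglyMeasurable measurableSet_Ioi) fun x hx => ?_) (fun x hx => ?_) hx₀ ?_
  · rw [abs_mul, abs_of_nonneg (Real.sqrt_nonneg _)]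
    have h1 : Real.sqrt (x / Real.pi) ≤ (1 + x) ^ 2 := by
      rw [Real.sqrt_le_left (by positivity)]
      have h2 : x / Real.pi ≤ x :=
        div_le_self hx.le (by linarith [Real.pi_gt_three])
      have h3 : (1 : ℝ) ≤ (1 + x) ^ 2 := by nlinarith
      nlinarith
    exact mul_le_mul (hfB x hx.le) h1 (Real.sqrt_nonneg _)
      ((abs_nonneg _).trans (hfB x hx.le))
  · have := nonneg_of_hasDerivWithinAt_of_monotone hmono hf hx
    positivity
  · have h1 : Real.sqrt (x₀ / Real.pi) ≠ 0 := (Real.sqrt_pos.2 (by positivity)).ne'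
    exact mul_ne_zero (mul_ne_zero hf0 h1) (mul_ne_zero (Real.exp_pos _).ne' hf0)

end Positivity

/-! ### The main theorem -/

theorem mainTheorem8
    {Ω : Type*} [MeasurableSpace Ω] (P : Measure Ω) [IsProbabilityMeasure P]
    -- an i.i.d. sequence of non-negative random variables with distribution function `F`
    (X : ℕ → Ω → ℝ) (hmeas : ∀ i, Measurable (X i))
    (hindep : iIndepFun X P) (hident : ∀ i, IdentDistrib (X i) (X 0) P P)
    (hnonneg : ∀ᵐ ω ∂P, 0 ≤ X 0 ω)
    (F f f' : ℝ → ℝ) (hF : ∀ x, F x = cdf (P.map (X 0)) x)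
    -- `F` is continuous, and its first two derivatives `f`, `f'` on `[0, ∞)` are continuous
    -- and bounded there (one-sided derivatives at `0`)
    (hFcont : Continuous F)
    (hf : ∀ x ∈ Set.Ici (0 : ℝ), HasDerivWithinAt F (f x) (Set.Ici 0) x)
    (hf' : ∀ x ∈ Set.Ici (0 : ℝ), HasDerivWithinAt f (f' x) (Set.Ici 0) x)
    (hf'cont : ContinuousOn f' (Set.Ici 0))
    (hfbdd : ∃ B : ℝ, ∀ x ∈ Set.Ici (0 : ℝ), |f x| ≤ B)
    (hf'bdd : ∃ B : ℝ, ∀ x ∈ Set.Ici (0 : ℝ), |f' x| ≤ B)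
    (a : ℝ) (ha : 0 < a) :
    -- the constants are such that `m_opt` is meaningful
    (0 < szaszC2 f a ∧ 0 < szaszC3 f f' a) ∧
    -- `m_opt` is asymptotically MISE-optimal, and leads to the stated MISE
    IsAsymptoticallyOptimal (szaszMISE P X F f a) (fun n => (n : ℝ) ^ (-(4 : ℝ) / 3))
      (szaszMOpt f f' a) ∧
    HasOptimalMISEExpansion P X F f f' a (szaszMOpt f f' a) ∧
    -- up to asymptotic equivalence (e.g. rounding to an integer) it is the only optimal choice
    (∀ m : ℕ → ℝ,
      IsAsymptoticallyOptimal (szaszMISE P X F f a) (fun n => (n : ℝ) ^ (-(4 : ℝ) / 3)) m ↔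
        m ~[atTop] szaszMOpt f f' a) ∧
    (∀ m : ℕ → ℝ, m ~[atTop] szaszMOpt f f' a → HasOptimalMISEExpansion P X F f f' a m) := by
  obtain ⟨B₀, hfB⟩ := hfbdd
  obtain ⟨B, hB⟩ := hf'bdd
  have := Measure.isProbabilityMeasure_map (μ := P) (hmeas 0).aemeasurable
  have hFeq : F = cdf (P.map (X 0)) := funext hF
  have hmono : Monotone F := hFeq ▸ monotone_cdf _
  have hF1 : ∀ y, |F y| ≤ 1 := fun y => by
    rw [hF, abs_of_nonneg (cdf_nonneg _ _)]; exact cdf_le_one _ _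
  have hFtop : Tendsto F atTop (𝓝 1) := hFeq ▸ tendsto_cdf_atTop _
  have hneg : ∀ y < 0, F y = 0 := fun y hy => by
    rw [hF, ← integral_indicator_Iic_eq_cdf (hmeas 0)]
    refine integral_eq_zero_of_ae ?_
    filter_upwards [hnonneg] with ω hω
    have : X 0 ω ∉ Iic y := fun h => absurd (mem_Iic.1 h) (by linarith)
    simp [this]
  -- F vanishes to the left of 0, and continuity excludes an atom at 0.
  have hF0 : F 0 = 0 := tendsto_nhds_unique
    (hFcont.continuousAt.mono_left (nhdsWithin_le_nhds (s := Iio (0 : ℝ))))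
    (tendsto_const_nhds.congr' (by
      filter_upwards [self_mem_nhdsWithin] with x hx using (hneg x hx).symm))
  have hfcont : ContinuousOn f (Ici 0) := fun x hx => (hf' x hx).continuousWithinAt
  -- One point where neither f nor f' vanishes serves both C₂ and C₃.
  obtain ⟨x₀, hx₀, hfx₀, hf'x₀⟩ := exists_deriv_mul_ne_zero hmono hFcont hF0 hF1 hFtop hf hf'
  have hC₂ := szaszC2_pos ha hmono hf hfcont hfB hx₀ hfx₀
  have hC₃ := szaszC3_pos ha hmono hf hfcont hf'cont hfB hB hx₀ hfx₀ hf'x₀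
  have h : IsVarianceBiasCriterion (szaszMISE P X F f a) (szaszIntegratedVariance F f a)
      (szaszIntegratedSqBias F f a) (szaszC1 F f a) (szaszC2 f a) (szaszC3 f f' a) :=
    { pos_variance := hC₂
      pos_bias := hC₃
      eq := fun x hx n hn =>
        szaszMISE_eq hmeas hindep hident hF hFcont hF1 hfcont hfB ha hx hn
      variance := tendsto_sqrt_mul_szaszIntegratedVariance_sub ha hFcont hF1 hf hf' hfB hB
      bias := tendsto_sq_mul_szaszIntegratedSqBias ha hFcont hF1 hf hf' hfB hB }
  -- `szaszMOpt f f' a` unfolds to `optimalSmoothing` at the constants C₂ and C₃, so the abstract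
  -- lemmas apply definitionally.
  have hexp : ∀ m : ℕ → ℝ, m ~[atTop] szaszMOpt f f' a →
      HasOptimalMISEExpansion P X F f f' a m := fun m hm =>
    (isLittleO_iff_tendsto_rescaledExcess hC₂ hC₃).2 (h.tendsto_rescaledExcess hm)
  exact ⟨⟨hC₂, hC₃⟩, h.isAsymptoticallyOptimal_of_isEquivalent IsEquivalent.refl,
    hexp _ IsEquivalent.refl, fun m => ⟨h.isEquivalent_of_isAsymptoticallyOptimal,
      h.isAsymptoticallyOptimal_of_isEquivalent⟩, hexp⟩
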